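/- For $x>0$ let $$T[s,x]=\int_0^\infty\frac{\cos(xu)}{(u^2+1)^{s+1/2}}\,du\quad(\operatorname{Re}s>0),\qquad K[s,x]=\int_0^\infty e^{-x\cosh t}\cosh(st)\,dt\quad(s\in\mathbb C),$$ the latter being the modified Bessel function of the second kind, and let $S(s)=(2/x)^s$, $G(s)=\Gamma(s+\tfrac12)$. Dots on $T,K,S,G$ denote derivatives with respect to the order $s$, and $T,K,S,G$ and their derivatives are evaluated at $s=\tfrac12$ unless the argument is shown. Then, for every $x>0$: (1) $T[\cdot,x]$ and $K[\cdot,x]$ are holomorphic at $s=\tfrac12$, with $T[\tfrac12,x]=\frac{\pi}{2}e^{-x}$ and $K[\tfrac12,x]=\sqrt{\frac{\pi}{2x}}\,e^{-x}$. All the integrals below converge absolutely, as do the integrals $\int_0^\infty e^{-xu}\frac{\log^a(u+2)\log^b u}{(u+2)^{\epsilon}}\,du$ for all integers $a,b,\epsilon\ge 0$. (2) $\displaystyle \ddot T=\int_0^\infty\cos(xu)\,\frac{\log^2(u^2+1)}{u^2+1}\,du,$ and $$\frac{\ddot T}{T}=\log^2 2-2\zeta(2)-2\int_0^\infty e^{-xu}\frac{\log(u+2)}{u+2}\,du-4\int_0^\infty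 e^{-xu}\frac{\log u}{u+2}\,du+2x\int_0^\infty e^{-xu}\log(u+2)\log u\,du+x\int_0^\infty e^{-xu}\log^2u\,du .$$ (3) $\displaystyle \frac{\dot T}{T}=E(x)+\log x-\Gamma'(1)-\log 2,$ where $E(x)=\int_0^\infty\frac{e^{-u}}{u+2x}\,du$. (4) $$\frac{\ddot K}{K}=\frac{\ddot S}{S}+\frac{\ddot G}{G}+\frac{\ddot T}{T}+2\Big(\frac{\dot S}{S}\frac{\dot G}{G}+\frac{\dot S}{S}\frac{\dot T}{T}+\frac{\dot G}{G}\frac{\dot T}{T}\Big).$$ (5) $\displaystyle x\int_0^\infty e^{-xu}\log^2u\,du=\Gamma''(1)-2\log x\,\Gamma'(1)+\log^2x$. Consequently the part $\frac{\ddot G}{G}+2\frac{\dot G}{G}\frac{\dot T}{T}+\frac{\ddot T}{T}$ of $\ddot K/K$ equals $$\big(2\Gamma''(1)-2\Gamma'(1)^2-2\zeta(2)\big)+2\Gamma'(1)\big(E(x)-\log2\big)+\log^22+\log^2x-2\int_0^\infty e^{-xu}\frac{\log(u+2)}{u+2}\,du-4\int_0^\infty e^{-xu}\frac{\log u}{u+2}\,du+2x\int_0^\infty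 e^{-xu}\log(u+2)\log u\,du,$$ and its first bracket vanishes: $2\Gamma''(1)-2\Gamma'(1)^2-2\zeta(2)=0$. -/

import Mathlib

open MeasureTheory Set

noncomputable section

/-- The cosine transform `T[s, x] = ∫₀^∞ cos (x u) / (u² + 1) ^ (s + 1/2) du` of a complex
order `s` and a real `x`. The integral converges absolutely for `0 < Re s`, which is a
neighbourhood of the point `s = 1/2` at which it is differentiated. -/
def besselT (s : ℂ) (x : ℝ) : ℂ :=
  ∫ u in Ioi (0 : ℝ), (Real.cos (x * u) : ℂ) / ((u ^ 2 + 1 : ℝ) : ℂ) ^ (s + 1 / 2)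

/-- The modified Bessel function of the second kind of complex order `s`, for `x > 0`:
`K[s, x] = ∫₀^∞ exp (-x cosh t) cosh (s t) dt`. -/
def besselK (s : ℂ) (x : ℝ) : ℂ :=
  ∫ t in Ioi (0 : ℝ), (Real.exp (-x * Real.cosh t) : ℂ) * Complex.cosh (s * t)

/-- The factor `S = (2 / x) ^ s`. -/
def powS (s : ℂ) (x : ℝ) : ℂ := ((2 / x : ℝ) : ℂ) ^ s

/-- The factor `Γ(s + 1/2)`, as a function of `s`. -/
def gammaHalf (s : ℂ) : ℂ := Complex.Gamma (s + 1 / 2)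

/-- The integral `U[a, b, ε] = ∫₀^∞ e^(-x u) log^a (u + 2) log^b u / (u + 2)^ε du`. -/
def logIntegral (a b ε : ℕ) (x : ℝ) : ℝ :=
  ∫ u in Ioi (0 : ℝ),
    Real.exp (-x * u) * (Real.log (u + 2) ^ a * Real.log u ^ b / (u + 2) ^ ε)

/-- The integral `∫₀^∞ e^(-u) / (u + 2 x) du`. -/
def expIntegral (x : ℝ) : ℝ := ∫ u in Ioi (0 : ℝ), Real.exp (-u) / (u + 2 * x)

end

/-!
The function `K[s, x]` has two integral representations. Basset's formula
(`powS_mul_gammaHalf_mul_besselT`) says `S G T = √π K`, and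
`two_mul_powS_mul_gammaHalf_mul_besselK` says `2 S G K = √π V`, where
`V(s) = 2 exp (-x) ∫ exp (-x u) (u (u + 2)) ^ (s - 1/2) du`.
Both follow from inserting Euler's integral for the Gamma function and exchanging the integrations
(`Gamma_mul_integral_mul_cpow`); what remains is the Fourier transform of a Gaussian in the first
case, and the elementary value of `K` at order `1/2` in the second. Eliminating `K` gives
`T (S G)² = (π / 2) V` (`besselT_mul_sq`).

Each of `S`, `G`, `T`, `K` and `V` is holomorphic and nonzero at `s = 1/2`, and the quotients
`f' / f` and `f'' / f` obey simple product rules. Basset's formula then gives `K'' / K`, and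
`besselT_mul_sq` gives `T' / T` and `T'' / T` in terms of the derivatives of `S` and `G` and the
integrals of `exp (-x u) (log u + log (u + 2)) ^ k` for `k = 1, 2`. Those without `log (u + 2)` are
derivatives of `x ^ (-s) Γ(s)` at `1`, and those without `log u` are integrated by parts
(`mul_logIntegral_succ`).

The result for `T'' / T` contains `E(x)` multiplied by `log x`, whereas the asserted formula has the
integral of `exp (-x u) log u / (u + 2)` instead. The two agree by `logIntegral_add_logIntegral`:
after multiplication by `exp (-2 x)` both sides have the same derivative in `x` and tend to zero at
infinity. Finally `Γ''(1) - Γ'(1)² = ζ(2)` is read off from the reflection formula.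
-/

/-! ### Derivatives of products, of exponential integrals and of Mellin transforms -/

section GeneralLemmas

open Filter Topology Asymptotics

/-- The quotient `f'' / f` of a product. Together with `deriv_mul_div` it lets the derivatives of
one factor of a known product be solved for, without differentiating a quotient. -/
theorem iteratedDeriv_two_mul_div {f g : ℂ → ℂ} {a : ℂ} (hf : AnalyticAt ℂ f a)
    (hg : AnalyticAt ℂ g a) (hf0 : f a ≠ 0) (hg0 : g a ≠ 0) :
    iteratedDeriv 2 (fun s => f s * g s) a / (f a * g a) =
      iteratedDeriv 2 f a / f a + 2 * (deriv f a / f a * (deriv g a / g a))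
        + iteratedDeriv 2 g a / g a := by
  rw [iteratedDeriv_fun_mul hf.contDiffAt hg.contDiffAt]
  simp [Finset.sum_range_succ, iteratedDeriv_one]
  field_simp
  ring

theorem deriv_mul_div {f g : ℂ → ℂ} {a : ℂ} (hf : AnalyticAt ℂ f a)
    (hg : AnalyticAt ℂ g a) (hf0 : f a ≠ 0) (hg0 : g a ≠ 0) :
    deriv (fun s => f s * g s) a / (f a * g a) = deriv f a / f a + deriv g a / g a := by
  rw [deriv_fun_mul hf.differentiableAt hg.differentiableAt]
  field_simp

section ExponentialParameter

variable {μ : Measure ℝ} {g : ℝ → ℂ} {L : ℝ → ℝ}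

/-- The integrability hypothesis of `hasDerivAt_integral_mul_cexp` passes from `g` to `-L g`, so
that the differentiation can be iterated. -/
theorem integrable_neg_mul_mul_exp (hL : Measurable L) (hL0 : ∀ᵐ u ∂μ, 0 ≤ L u)
    (hg : ∀ σ : ℝ, 0 < σ → Integrable (fun u => g u * (Real.exp (-σ * L u) : ℂ)) μ)
    {σ : ℝ} (hσ : 0 < σ) :
    Integrable (fun u => (-(L u : ℂ) * g u) * (Real.exp (-σ * L u) : ℂ)) μ := by
  have h2 : 0 < σ / 2 := by positivity
  -- Half of the exponential absorbs the factor `L`: `L exp (-(σ / 2) L) ≤ 2 / σ`.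
  have key := ((hg _ h2).norm.const_mul (2 / σ))
  have e : (fun u => (-(L u : ℂ) * g u) * (Real.exp (-σ * L u) : ℂ)) =
      fun u => (-(L u : ℂ) * Real.exp (-(σ / 2) * L u)) *
        (g u * (Real.exp (-(σ / 2) * L u) : ℂ)) := by
    funext u
    have : Real.exp (-σ * L u) = Real.exp (-(σ / 2) * L u) * Real.exp (-(σ / 2) * L u) := by
      rw [← Real.exp_add]; ring_nf
    rw [this]; push_cast; ring
  rw [e]
  refine key.mono' (AEStronglyMeasurable.mul ?_ (hg _ h2).1) ?_
  · exact (by fun_prop :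
      Measurable fun u => -(L u : ℂ) * Real.exp (-(σ / 2) * L u)).aestronglyMeasurable
  · filter_upwards [hL0] with u hu
    rw [norm_mul]
    gcongr
    rw [norm_mul, norm_neg, Complex.norm_real, Complex.norm_real, Real.norm_of_nonneg hu,
      Real.norm_of_nonneg (Real.exp_pos _).le, neg_mul, Real.exp_neg, ← div_eq_mul_inv,
      div_le_div_iff₀ (Real.exp_pos _) hσ]
    have := Real.add_one_le_exp (σ / 2 * L u)
    linarith

/-- Differentiation under the integral sign for a Laplace-type integral with phase `L ≥ 0`. -/
theorem hasDerivAt_integral_mul_cexp (hL : Measurable L) (hL0 : ∀ᵐ u ∂μ, 0 ≤ L u)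
    (hg : ∀ σ : ℝ, 0 < σ → Integrable (fun u => g u * (Real.exp (-σ * L u) : ℂ)) μ)
    {s : ℂ} (hs : 0 < s.re) :
    HasDerivAt (fun s : ℂ => ∫ u, g u * Complex.exp (-s * L u) ∂μ)
      (∫ u, (-(L u : ℂ) * g u) * Complex.exp (-s * L u) ∂μ) s := by
  have hgm : AEStronglyMeasurable g μ := by
    have h1 : AEStronglyMeasurable (fun u => (Real.exp (L u) : ℂ)) μ :=
      (by fun_prop : Measurable fun u => (Real.exp (L u) : ℂ)).aestronglyMeasurable
    refine ((hg 1 one_pos).1.mul h1).congr (ae_of_all _ fun u => ?_)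
    have : (Real.exp (-1 * L u) : ℂ) * Real.exp (L u) = 1 := by
      rw [← Complex.ofReal_mul, ← Real.exp_add]; simp
    simp only [Pi.mul_apply]
    rw [mul_assoc, this, mul_one]
  have hE : ∀ z : ℂ, AEStronglyMeasurable (fun u => Complex.exp (-z * L u)) μ := fun z =>
    (by fun_prop : Measurable fun u => Complex.exp (-z * L u)).aestronglyMeasurable
  have hn : ∀ (z : ℂ) (u : ℝ), ‖Complex.exp (-z * L u)‖ = Real.exp (-z.re * L u) := by
    intro z u; rw [Complex.norm_exp]; simp
  have h2 : 0 < s.re / 2 := by positivity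
  refine (hasDerivAt_integral_of_dominated_loc_of_deriv_le (μ := μ)
    (F := fun (z : ℂ) u => g u * Complex.exp (-z * L u))
    (F' := fun (z : ℂ) u => (-(L u : ℂ) * g u) * Complex.exp (-z * L u))
    (s := {z | s.re / 2 < z.re})
    (bound := fun u => ‖(-(L u : ℂ) * g u) * (Real.exp (-(s.re / 2) * L u) : ℂ)‖)
    ?_ ?_ ?_ ?_ ?_ ?_ ?_).2
  · exact (isOpen_lt continuous_const Complex.continuous_re).mem_nhds (by
      simp only [mem_ofPred_eq]; linarith)
  · exact Eventually.of_forall fun z => hgm.mul (hE z)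
  · refine (hg _ hs).mono (hgm.mul (hE s)) (ae_of_all _ fun u => ?_)
    simp only [norm_mul, hn, Complex.norm_real, Real.norm_of_nonneg (Real.exp_pos _).le, le_refl]
  · exact ((by fun_prop : Measurable fun u => -(L u : ℂ)).aestronglyMeasurable.mul hgm).mul (hE s)
  · filter_upwards [hL0] with u hu z hz
    simp only [norm_mul, hn, Complex.norm_real, Real.norm_of_nonneg (Real.exp_pos _).le]
    gcongr
  · exact (integrable_neg_mul_mul_exp hL hL0 hg h2).norm
  · refine ae_of_all _ fun u z _ => ?_
    have h : HasDerivAt (fun z : ℂ => -z * (L u : ℂ)) (-1 * (L u : ℂ)) z :=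
      ((hasDerivAt_id z).neg).mul_const _
    refine (h.cexp.const_mul (g u)).congr_deriv ?_
    ring

end ExponentialParameter

/-- Locally integrable functions on the half-line that decay faster than every power at infinity and
grow more slowly than every negative power at zero. Their Mellin transforms converge for `0 < Re s`,
and the class is closed under multiplication by `log`, that is, under differentiating the
transform. -/
structure MellinRegular (f : ℝ → ℂ) : Prop where
  locallyIntegrableOn : LocallyIntegrableOn f (Ioi 0)
  isBigO_atTop : ∀ a : ℝ, f =O[atTop] (· ^ (-a))
  isBigO_zero : ∀ b : ℝ, 0 < b → f =O[𝓝[>] 0] (· ^ (-b))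

namespace MellinRegular

variable {f : ℝ → ℂ}

theorem of_continuousOn (hc : ContinuousOn f (Ioi 0))
    (ht : ∀ a : ℝ, f =O[atTop] (· ^ (-a))) (h0 : f =O[𝓝[>] 0] (fun _ => (1 : ℝ))) :
    MellinRegular f where
  locallyIntegrableOn := hc.locallyIntegrableOn measurableSet_Ioi
  isBigO_atTop := ht
  isBigO_zero b hb := by
    refine h0.trans (IsBigO.of_bound 1 ?_)
    filter_upwards [Ioo_mem_nhdsGT (zero_lt_one' ℝ)] with t ht
    rw [one_mul, norm_one, Real.norm_of_nonneg (Real.rpow_nonneg ht.1.le _)]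
    exact Real.one_le_rpow_of_pos_of_le_one_of_nonpos ht.1 ht.2.le (by linarith)

theorem log_smul (hf : MellinRegular f) : MellinRegular (fun t => Real.log t • f t) where
  locallyIntegrableOn := by
    refine hf.locallyIntegrableOn.continuousOn_smul isOpen_Ioi.isLocallyClosed ?_
    exact Real.continuousOn_log.mono fun t ht => (ne_of_gt ht : t ≠ 0)
  isBigO_atTop a := isBigO_rpow_top_log_smul (lt_add_one a) (hf.isBigO_atTop _)
  isBigO_zero b hb := isBigO_rpow_zero_log_smul (half_lt_self hb) (hf.isBigO_zero _ (half_pos hb))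

theorem log_pow_mul (hf : MellinRegular f) (n : ℕ) :
    MellinRegular (fun t => (Real.log t : ℂ) ^ n * f t) := by
  induction n with
  | zero => simpa using hf
  | succ n ih =>
    convert ih.log_smul using 2 with t
    rw [Complex.real_smul]; ring

theorem mellinConvergent (hf : MellinRegular f) {s : ℂ} (hs : 0 < s.re) : MellinConvergent f s :=
  mellinConvergent_of_isBigO_rpow hf.locallyIntegrableOn (hf.isBigO_atTop (s.re + 1))
    (lt_add_one _) (hf.isBigO_zero _ (half_pos hs)) (half_lt_self hs)

theorem hasDerivAt_mellin (hf : MellinRegular f) {s : ℂ} (hs : 0 < s.re) :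
    HasDerivAt (mellin f) (mellin (fun t => Real.log t • f t) s) s :=
  (mellin_hasDerivAt_of_isBigO_rpow hf.locallyIntegrableOn (hf.isBigO_atTop (s.re + 1))
    (lt_add_one _) (hf.isBigO_zero _ (half_pos hs)) (half_lt_self hs)).2

theorem integrableOn (hf : MellinRegular f) : IntegrableOn f (Ioi 0) := by
  simpa [MellinConvergent] using hf.mellinConvergent (s := 1) (by simp)

theorem analyticAt_mellin (hf : MellinRegular f) {s : ℂ} (hs : 0 < s.re) :
    AnalyticAt ℂ (mellin f) s := by
  have ho : IsOpen {z : ℂ | 0 < z.re} := isOpen_lt continuous_const Complex.continuous_re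
  refine DifferentiableOn.analyticAt (s := {z : ℂ | 0 < z.re}) (fun z hz => ?_) (ho.mem_nhds hs)
  exact (hf.hasDerivAt_mellin hz).differentiableAt.differentiableWithinAt

theorem iteratedDeriv_two_mellin (hf : MellinRegular f) {s : ℂ} (hs : 0 < s.re) :
    iteratedDeriv 2 (mellin f) s = mellin (fun t => (Real.log t : ℂ) ^ 2 * f t) s := by
  have ho : IsOpen {z : ℂ | 0 < z.re} := isOpen_lt continuous_const Complex.continuous_re
  have h1 : deriv (mellin f) =ᶠ[𝓝 s] mellin (fun t => Real.log t • f t) := by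
    filter_upwards [ho.mem_nhds hs] with z hz
    exact (hf.hasDerivAt_mellin hz).deriv
  rw [iteratedDeriv_succ, iteratedDeriv_one, h1.deriv_eq, (hf.log_smul.hasDerivAt_mellin hs).deriv]
  congr 1
  funext t
  simp only [Complex.real_smul]
  ring

end MellinRegular

end GeneralLemmas

/-! ### The Bessel function as a Mellin transform -/

section BesselKernel

open Filter Topology

/-- Euler's integral for `Γ(a) / r(u) ^ a` inserted under an integral, and the order of integration
exchanged. Both integral representations of `Γ(s + 1/2) K[s, x]` come from this. -/
theorem Gamma_mul_integral_mul_cpow {a : ℂ} (ha : 0 < a.re) {A : ℝ → ℂ} {r : ℝ → ℝ}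
    (hAm : AEStronglyMeasurable A (volume.restrict (Ioi 0))) (hr : Measurable r)
    (hr0 : ∀ u ∈ Ioi (0 : ℝ), 0 < r u)
    (hA : IntegrableOn (fun u => A u * (1 / (r u : ℂ)) ^ a) (Ioi 0)) :
    Complex.Gamma a * ∫ u in Ioi (0 : ℝ), A u * (1 / (r u : ℂ)) ^ a =
      ∫ τ in Ioi (0 : ℝ), (τ : ℂ) ^ (a - 1) *
        ∫ u in Ioi (0 : ℝ), A u * (Real.exp (-(r u * τ)) : ℂ) := by
  set μ := volume.restrict (Ioi (0 : ℝ)) with hμ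
  let F : ℝ → ℝ → ℂ := fun u τ => A u * ((τ : ℂ) ^ (a - 1) * (Real.exp (-(r u * τ)) : ℂ))
  have hFn : ∀ u τ : ℝ, 0 < τ →
      ‖F u τ‖ = ‖A u‖ * (τ ^ (a.re - 1) * Real.exp (-(r u * τ))) := by
    intro u τ hτ
    simp only [F, norm_mul, Complex.norm_real, Real.norm_of_nonneg (Real.exp_pos _).le,
      Complex.norm_cpow_eq_rpow_re_of_pos hτ, Complex.sub_re, Complex.one_re]
  have hpow : ∀ u ∈ Ioi (0 : ℝ), ‖(1 / (r u : ℂ)) ^ a‖ = (1 / r u) ^ a.re := by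
    intro u hu
    have := Complex.norm_cpow_eq_rpow_re_of_pos (one_div_pos.2 (hr0 u hu)) a
    push_cast at this ⊢
    exact this
  have hG : ∀ u ∈ Ioi (0 : ℝ),
      Integrable (fun τ : ℝ => τ ^ (a.re - 1) * Real.exp (-(r u * τ))) μ := by
    intro u hu
    have := integrableOn_rpow_mul_exp_neg_mul_rpow (s := a.re - 1) (p := 1) (b := r u)
      (by linarith) one_pos (hr0 u hu)
    simpa [IntegrableOn] using this
  have hFm : AEStronglyMeasurable (Function.uncurry F) (μ.prod μ) := by
    have h1 : AEStronglyMeasurable (fun p : ℝ × ℝ => A p.1) (μ.prod μ) := hAm.comp_fst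
    refine h1.mul (Measurable.aestronglyMeasurable ?_)
    fun_prop
  have hFi : Integrable (Function.uncurry F) (μ.prod μ) := by
    rw [integrable_prod_iff hFm]
    constructor
    · filter_upwards [ae_restrict_mem measurableSet_Ioi] with u hu
      refine ((hG u hu).const_mul ‖A u‖).mono' ?_ ?_
      · exact (by fun_prop : Measurable fun τ : ℝ =>
          A u * ((τ : ℂ) ^ (a - 1) * (Real.exp (-(r u * τ)) : ℂ))).aestronglyMeasurable
      · filter_upwards [ae_restrict_mem measurableSet_Ioi] with τ hτ
        exact (hFn u τ hτ).le
    · refine (hA.norm.const_mul (Real.Gamma a.re)).congr ?_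
      filter_upwards [ae_restrict_mem measurableSet_Ioi] with u hu
      have : ∫ τ, ‖Function.uncurry F (u, τ)‖ ∂μ =
          ∫ τ in Ioi (0 : ℝ), ‖A u‖ * (τ ^ (a.re - 1) * Real.exp (-(r u * τ))) :=
        setIntegral_congr_fun measurableSet_Ioi fun τ hτ => hFn u τ hτ
      rw [this, integral_const_mul, Real.integral_rpow_mul_exp_neg_mul_Ioi ha (hr0 u hu),
        norm_mul, hpow u hu]
      ring
  have hsw := integral_integral_swap hFi
  rw [← integral_const_mul]
  calc
    _ = ∫ u, ∫ τ, F u τ ∂μ ∂μ := by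
      refine setIntegral_congr_fun measurableSet_Ioi fun u hu => ?_
      simp only [F, hμ]
      rw [integral_const_mul]
      push_cast
      have := Complex.integral_cpow_mul_exp_neg_mul_Ioi ha (hr0 u hu)
      rw [this]
      ring
    _ = _ := by
      rw [hsw]
      refine setIntegral_congr_fun measurableSet_Ioi fun τ hτ => ?_
      simp only [F, hμ]
      rw [← integral_const_mul]
      congr 1
      funext u
      ring

/-- The kernel whose Mellin transform is `2 K[s, x]`. It is invariant under `t ↦ 1 / t`, which is
the evenness of `K` in its order. -/
noncomputable def besselKernel (x t : ℝ) : ℝ := Real.exp (-(x / 2 * (t + 1 / t)))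

theorem besselKernel_exp (x v : ℝ) :
    besselKernel x (Real.exp v) = Real.exp (-x * Real.cosh v) := by
  rw [besselKernel, Real.cosh_eq, one_div, ← Real.exp_neg]
  ring_nf

theorem mellinRegular_besselKernel {x : ℝ} (hx : 0 < x) :
    MellinRegular (fun t => (besselKernel x t : ℂ)) := by
  refine .of_continuousOn ?_ (fun a => .trans ?_
    (isLittleO_exp_neg_mul_rpow_atTop (half_pos hx) _).isBigO) ?_
  · refine Complex.continuous_ofReal.comp_continuousOn ?_
    unfold besselKernel
    refine Real.continuous_exp.comp_continuousOn ?_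
    refine ContinuousOn.neg (continuousOn_const.mul (continuousOn_id.add ?_))
    exact continuousOn_const.div continuousOn_id fun t ht => (ne_of_gt ht : t ≠ 0)
  · refine Asymptotics.IsBigO.of_bound 1 ?_
    filter_upwards [eventually_gt_atTop 0] with t ht
    rw [Complex.norm_real, besselKernel, Real.norm_of_nonneg (Real.exp_pos _).le,
      Real.norm_of_nonneg (Real.exp_pos _).le, one_mul, Real.exp_le_exp]
    have : 0 < x / 2 * (1 / t) := by positivity
    nlinarith
  · refine Asymptotics.IsBigO.of_bound 1 ?_
    filter_upwards [self_mem_nhdsWithin] with t ht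
    have ht : 0 < t := ht
    rw [Complex.norm_real, besselKernel, Real.norm_of_nonneg (Real.exp_pos _).le, norm_one,
      one_mul, Real.exp_le_one_iff]
    have : 0 < x / 2 * (t + 1 / t) := by positivity
    linarith

theorem exp_image_univ : Real.exp '' univ = Ioi 0 := by
  rw [image_univ, Real.range_exp]

theorem exp_smul_cpow_exp (v : ℝ) (s z : ℂ) :
    |Real.exp v| • ((Real.exp v : ℂ) ^ (s - 1) • z) = Complex.exp (s * v) * z := by
  rw [abs_of_pos (Real.exp_pos v), Complex.real_smul, smul_eq_mul, ← mul_assoc,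
    Complex.ofReal_exp, Complex.cpow_def_of_ne_zero (Complex.exp_ne_zero _),
    ← Complex.ofReal_exp, ← Complex.ofReal_log (Real.exp_pos _).le, Real.log_exp,
    Complex.ofReal_exp, ← Complex.exp_add]
  ring_nf

theorem mellin_besselKernel_inv (x : ℝ) (s : ℂ) :
    mellin (fun t => (besselKernel x t : ℂ)) (-s) = mellin (fun t => (besselKernel x t : ℂ)) s := by
  rw [← mellin_comp_inv]
  simp only [besselKernel, one_div, inv_inv, add_comm]

theorem integral_eq_integral_Ioi_add_comp_neg {F : ℝ → ℂ} (hF : Integrable F) :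
    ∫ v, F v = ∫ v in Ioi (0 : ℝ), (F (-v) + F v) := by
  rw [← intervalIntegral.integral_Iic_add_Ioi hF.integrableOn hF.integrableOn (b := 0)]
  have := integral_comp_neg_Ioi 0 F
  rw [neg_zero] at this
  rw [← this, ← integral_add hF.comp_neg.integrableOn hF.integrableOn]

/-- The substitution `t = exp v` in the Mellin transform. -/
theorem mellin_besselKernel {x : ℝ} (hx : 0 < x) {s : ℂ} (hs : 0 < s.re) :
    mellin (fun t => (besselKernel x t : ℂ)) s = 2 * besselK s x := by
  let F : ℝ → ℂ := fun v => Complex.exp (s * v) * (Real.exp (-x * Real.cosh v) : ℂ)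
  have hd : ∀ v ∈ (univ : Set ℝ), HasDerivWithinAt Real.exp (Real.exp v) univ v := fun v _ =>
    (Real.hasDerivAt_exp v).hasDerivWithinAt
  have hconv := (mellinRegular_besselKernel hx).mellinConvergent hs
  have hF : Integrable F := by
    rw [MellinConvergent, ← exp_image_univ, integrableOn_image_iff_integrableOn_abs_deriv_smul
      MeasurableSet.univ hd Real.exp_injective.injOn, integrableOn_univ] at hconv
    simpa only [exp_smul_cpow_exp, besselKernel_exp] using hconv
  have hm : mellin (fun t => (besselKernel x t : ℂ)) s = ∫ v, F v := by
    rw [mellin, ← exp_image_univ, integral_image_eq_integral_abs_deriv_smul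
      MeasurableSet.univ hd Real.exp_injective.injOn, setIntegral_univ]
    simp only [exp_smul_cpow_exp, besselKernel_exp, F]
  rw [hm, integral_eq_integral_Ioi_add_comp_neg hF, besselK, ← integral_const_mul]
  congr 1
  funext v
  simp only [F, Real.cosh_neg, Complex.cosh]
  push_cast
  rw [show s * -(v : ℂ) = -(s * v) by ring]
  ring

theorem analyticAt_besselK {x : ℝ} (hx : 0 < x) {s : ℂ} (hs : 0 < s.re) :
    AnalyticAt ℂ (fun s => besselK s x) s := by
  have ho : IsOpen {z : ℂ | 0 < z.re} := isOpen_lt continuous_const Complex.continuous_re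
  refine (analyticAt_const.mul ((mellinRegular_besselKernel hx).analyticAt_mellin hs)).congr
    (f := fun z => 2⁻¹ * mellin (fun t => (besselKernel x t : ℂ)) z) ?_
  filter_upwards [ho.mem_nhds hs] with z hz
  rw [mellin_besselKernel hx hz]
  ring

theorem sinh_half_image_Ioi : (fun t : ℝ => Real.sinh (t / 2)) '' Ioi 0 = Ioi 0 := by
  ext w
  constructor
  · rintro ⟨t, ht, rfl⟩
    exact Real.sinh_pos_iff.2 (half_pos ht)
  · intro hw
    refine ⟨2 * Real.arsinh w, ?_, ?_⟩
    · have : 0 < Real.arsinh w := Real.arsinh_pos_iff.2 hw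
      simpa using this
    · simp only [mul_div_cancel_left₀ _ (two_ne_zero' ℝ), Real.sinh_arsinh]

/-- The substitution `w = sinh (t / 2)`, with `cosh t = 1 + 2 w²`, gives a Gaussian integral. For
`x ≤ 0` both sides are zero. -/
theorem besselK_one_half (x : ℝ) :
    besselK (1 / 2) x = ((Real.sqrt (Real.pi / (2 * x)) * Real.exp (-x) : ℝ) : ℂ) := by
  have h1 : besselK (1 / 2) x =
      ((∫ t in Ioi (0 : ℝ), Real.exp (-x * Real.cosh t) * Real.cosh (t / 2) : ℝ) : ℂ) := by
    rw [besselK, ← integral_complex_ofReal]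
    congr 1
    funext t
    push_cast
    congr 2
    ring
  rw [h1]
  congr 1
  have hd : ∀ t ∈ Ioi (0 : ℝ), HasDerivWithinAt (fun t : ℝ => Real.sinh (t / 2))
      (Real.cosh (t / 2) * (1 / 2)) (Ioi 0) t := fun t _ =>
    (((hasDerivAt_id t).div_const 2).sinh).hasDerivWithinAt
  have hi : InjOn (fun t : ℝ => Real.sinh (t / 2)) (Ioi 0) := by
    intro a _ b _ hab
    have := Real.sinh_injective hab
    linarith
  have key := integral_image_eq_integral_abs_deriv_smul measurableSet_Ioi hd hi
    (fun w => 2 * Real.exp (-x) * Real.exp (-(2 * x) * w ^ 2))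
  rw [sinh_half_image_Ioi, integral_const_mul, integral_gaussian_Ioi] at key
  have e : ∀ t : ℝ, Real.exp (-x * Real.cosh t) * Real.cosh (t / 2) =
      |Real.cosh (t / 2) * (1 / 2)| •
        (2 * Real.exp (-x) * Real.exp (-(2 * x) * Real.sinh (t / 2) ^ 2)) := by
    intro t
    have hc : Real.cosh t = 1 + 2 * Real.sinh (t / 2) ^ 2 := by
      have := Real.cosh_two_mul (t / 2)
      rw [Real.cosh_sq, mul_div_cancel₀ _ (two_ne_zero' ℝ)] at this
      linarith
    rw [abs_of_pos (by have := Real.cosh_pos (t / 2); positivity), smul_eq_mul, hc,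
      show -x * (1 + 2 * Real.sinh (t / 2) ^ 2) = -x + -(2 * x) * Real.sinh (t / 2) ^ 2 by ring,
      Real.exp_add]
    ring
  simp_rw [e]
  rw [← key]
  ring

end BesselKernel

/-! ### The two integral representations of the Bessel function -/

section BesselRelations

open Filter Topology

theorem one_div_ofReal_cpow {r : ℝ} (hr : 0 < r) (a : ℂ) :
    (1 / (r : ℂ)) ^ a = 1 / (r : ℂ) ^ a := by
  rw [one_div, one_div, Complex.inv_cpow]
  rw [Complex.arg_ofReal_of_nonneg hr.le]
  exact Real.pi_ne_zero.symm

/-- The Fourier transform of a Gaussian, as an integral over the half-line. -/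
theorem integral_cos_mul_exp_neg_mul_sq (x : ℝ) {τ : ℝ} (hτ : 0 < τ) :
    ∫ u in Ioi (0 : ℝ), ((Real.cos (x * u) * Real.exp (-τ * u ^ 2) : ℝ) : ℂ) =
      ((Real.sqrt (Real.pi / τ) / 2 * Real.exp (-(x ^ 2 / (4 * τ))) : ℝ) : ℂ) := by
  let F : ℝ → ℂ := fun u => Complex.exp (Complex.I * x * u) * Complex.exp (-(τ : ℂ) * u ^ 2)
  have hF : Integrable F := by
    have := integrable_cexp_neg_mul_sq (b := (τ : ℂ)) (by simpa using hτ)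
    refine this.mono (by fun_prop) (ae_of_all _ fun u => ?_)
    simp only [F]
    rw [norm_mul, show Complex.I * x * u = ((x * u : ℝ) : ℂ) * Complex.I by push_cast; ring,
      Complex.norm_exp_ofReal_mul_I, one_mul]
  have h1 := fourierIntegral_gaussian (b := (τ : ℂ)) (by simpa using hτ) (x : ℂ)
  change ∫ u, F u = _ at h1
  rw [integral_eq_integral_Ioi_add_comp_neg hF] at h1
  have h2 : ∀ u : ℝ, F (-u) + F u =
      2 * ((Real.cos (x * u) * Real.exp (-τ * u ^ 2) : ℝ) : ℂ) := by
    intro u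
    simp only [F]
    push_cast
    rw [Complex.cos]
    ring_nf
  simp_rw [h2] at h1
  rw [integral_const_mul] at h1
  have h3 : ((Real.pi : ℂ) / τ) ^ (1 / 2 : ℂ) = (Real.sqrt (Real.pi / τ) : ℂ) := by
    rw [Real.sqrt_eq_rpow, Complex.ofReal_cpow (by positivity)]
    push_cast
    rfl
  rw [h3] at h1
  push_cast at h1 ⊢
  rw [neg_div] at h1
  linear_combination h1 / 2

theorem integrable_one_add_sq_rpow {σ : ℝ} (hσ : 0 < σ) :
    IntegrableOn (fun u : ℝ => (u ^ 2 + 1) ^ (-(σ + 1 / 2))) (Ioi 0) := by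
  have := integrable_rpow_neg_one_add_norm_sq (E := ℝ) (μ := volume) (r := 2 * σ + 1)
    (by simp; linarith)
  refine (this.congr (ae_of_all _ fun u => ?_)).integrableOn
  simp only [Real.norm_eq_abs, sq_abs]
  rw [add_comm]
  congr 1
  ring

theorem cpow_sub_half_mul_sqrt {τ : ℝ} (hτ : 0 < τ) (s : ℂ) :
    (τ : ℂ) ^ (s + 1 / 2 - 1) * (Real.sqrt (Real.pi / τ) : ℂ) =
      (Real.sqrt Real.pi : ℂ) * (τ : ℂ) ^ (s - 1) := by
  have h0 : (τ : ℂ) ≠ 0 := by exact_mod_cast hτ.ne'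
  rw [show s + 1 / 2 - 1 = (s - 1) + 1 / 2 by ring, Complex.cpow_add _ _ h0,
    Real.sqrt_div Real.pi_pos.le]
  have : (τ : ℂ) ^ (1 / 2 : ℂ) = (Real.sqrt τ : ℂ) := by
    rw [Real.sqrt_eq_rpow, Complex.ofReal_cpow hτ.le]; push_cast; rfl
  have hs : (Real.sqrt τ : ℂ) ≠ 0 := by exact_mod_cast (Real.sqrt_pos.2 hτ).ne'
  rw [this]
  push_cast
  field_simp

/-- Basset's formula, `K[s, x] = π^(-1/2) (2 / x) ^ s Γ(s + 1/2) T[s, x]`. -/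
theorem powS_mul_gammaHalf_mul_besselT {x : ℝ} (hx : 0 < x) {s : ℂ} (hs : 0 < s.re) :
    powS s x * (gammaHalf s * besselT s x) = (Real.sqrt Real.pi : ℂ) * besselK s x := by
  have ha : 0 < (s + 1 / 2).re := by simp; linarith
  have hr0 : ∀ u ∈ Ioi (0 : ℝ), 0 < u ^ 2 + 1 := fun u _ => by positivity
  have hT : besselT s x = ∫ u in Ioi (0 : ℝ), (Real.cos (x * u) : ℂ) *
      (1 / ((u ^ 2 + 1 : ℝ) : ℂ)) ^ (s + 1 / 2) := by
    refine setIntegral_congr_fun measurableSet_Ioi fun u hu => ?_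
    rw [one_div_ofReal_cpow (hr0 u hu), mul_one_div]
  have hint : IntegrableOn (fun u : ℝ => (Real.cos (x * u) : ℂ) *
      (1 / ((u ^ 2 + 1 : ℝ) : ℂ)) ^ (s + 1 / 2)) (Ioi 0) := by
    refine (integrable_one_add_sq_rpow hs).mono' (by fun_prop) ?_
    filter_upwards [ae_restrict_mem measurableSet_Ioi] with u hu
    have h := hr0 u hu
    rw [one_div_ofReal_cpow h, norm_mul, norm_div, norm_one,
      Complex.norm_cpow_eq_rpow_re_of_pos h, Complex.norm_real, Real.norm_eq_abs,
      Real.rpow_neg h.le, one_div]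
    have h2 : (s + 1 / 2).re = s.re + 1 / 2 := by simp
    rw [h2]
    exact mul_le_of_le_one_left (by positivity) (Real.abs_cos_le_one _)
  have key := Gamma_mul_integral_mul_cpow ha (A := fun u => (Real.cos (x * u) : ℂ))
    (by fun_prop) (by fun_prop) hr0 hint
  rw [← hT] at key
  have hinner : ∀ τ ∈ Ioi (0 : ℝ), (τ : ℂ) ^ (s + 1 / 2 - 1) *
      ∫ u in Ioi (0 : ℝ), (Real.cos (x * u) : ℂ) * (Real.exp (-((u ^ 2 + 1) * τ)) : ℂ) =
      ((Real.sqrt Real.pi : ℂ) / 2) *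
        ((τ : ℂ) ^ (s - 1) • (besselKernel x (2 / x * τ) : ℂ)) := by
    intro τ hτ
    have hτ : 0 < τ := hτ
    have e : ∀ u : ℝ, (Real.cos (x * u) : ℂ) * (Real.exp (-((u ^ 2 + 1) * τ)) : ℂ) =
        (Real.exp (-τ) : ℂ) * ((Real.cos (x * u) * Real.exp (-τ * u ^ 2) : ℝ) : ℂ) := by
      intro u
      rw [show -((u ^ 2 + 1) * τ) = -τ + -τ * u ^ 2 by ring, Real.exp_add]
      push_cast
      ring
    have hk : besselKernel x (2 / x * τ) = Real.exp (-τ) * Real.exp (-(x ^ 2 / (4 * τ))) := by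
      rw [besselKernel, ← Real.exp_add]
      congr 1
      field_simp
      ring
    simp_rw [e]
    rw [integral_const_mul, integral_cos_mul_exp_neg_mul_sq x hτ, hk]
    have := cpow_sub_half_mul_sqrt hτ s
    push_cast
    rw [smul_eq_mul]
    linear_combination (Complex.exp (-τ) * Complex.exp (-(x ^ 2 / (4 * τ))) / 2) * this
  rw [setIntegral_congr_fun measurableSet_Ioi hinner, integral_const_mul] at key
  change _ = _ * mellin (fun τ => (besselKernel x (2 / x * τ) : ℂ)) s at key
  have h2x : 0 < 2 / x := by positivity
  rw [mellin_comp_mul_left (fun t => (besselKernel x t : ℂ)) s h2x, mellin_besselKernel hx hs,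
    smul_eq_mul] at key
  have hS : powS s x * ((2 / x : ℝ) : ℂ) ^ (-s) = 1 := by
    rw [powS, ← Complex.cpow_add _ _ (by exact_mod_cast h2x.ne'), add_neg_cancel,
      Complex.cpow_zero]
  rw [gammaHalf, key]
  linear_combination ((Real.sqrt Real.pi : ℂ) * besselK s x) * hS

/-- The function `(1 + p)^(-1/2) exp (-x (1 + p)^(1/2))`. By the substitution `1 + p = (1 + u)²` its
Mellin transform at `s + 1/2` is `2 exp (-x) ∫ exp (-x u) (u (u + 2)) ^ (s - 1/2) du`. -/
noncomputable def shiftedKernel (x p : ℝ) : ℝ :=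
  Real.exp (-x * Real.sqrt (1 + p)) / Real.sqrt (1 + p)

theorem mellinRegular_shiftedKernel {x : ℝ} (hx : 0 < x) :
    MellinRegular (fun p => (shiftedKernel x p : ℂ)) := by
  have hle : ∀ p : ℝ, 0 < p → ‖(shiftedKernel x p : ℂ)‖ ≤ Real.exp (-x * Real.sqrt p) := by
    intro p hp
    have h1 : 1 ≤ Real.sqrt (1 + p) := Real.one_le_sqrt.2 (by linarith)
    have h2 : Real.sqrt p ≤ Real.sqrt (1 + p) := Real.sqrt_le_sqrt (by linarith)
    rw [Complex.norm_real, shiftedKernel, Real.norm_of_nonneg (by positivity)]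
    refine (div_le_self (Real.exp_pos _).le h1).trans (Real.exp_le_exp.2 ?_)
    nlinarith
  refine .of_continuousOn ?_ (fun a => ?_) ?_
  · refine Complex.continuous_ofReal.comp_continuousOn ?_
    unfold shiftedKernel
    refine ContinuousOn.div (by fun_prop) (by fun_prop) fun p hp => ?_
    have : 0 < p := hp
    positivity
  · have h1 : (fun p => (shiftedKernel x p : ℂ)) =O[atTop]
        fun p : ℝ => Real.exp (-x * Real.sqrt p) := by
      refine Asymptotics.IsBigO.of_bound 1 ?_
      filter_upwards [eventually_gt_atTop 0] with p hp
      rw [one_mul, Real.norm_of_nonneg (Real.exp_pos _).le]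
      exact hle p hp
    have h2 := (isLittleO_exp_neg_mul_rpow_atTop hx (-(2 * a))).isBigO.comp_tendsto
      Real.tendsto_sqrt_atTop
    refine (h1.trans h2).congr' EventuallyEq.rfl ?_
    filter_upwards [eventually_gt_atTop 0] with p hp
    simp only [Function.comp]
    rw [Real.sqrt_eq_rpow, ← Real.rpow_mul hp.le]
    congr 1
    ring
  · refine Asymptotics.IsBigO.of_bound 1 ?_
    filter_upwards [self_mem_nhdsWithin] with p hp
    rw [norm_one, mul_one]
    refine (hle p hp).trans (Real.exp_le_one_iff.2 ?_)
    have := Real.sqrt_nonneg p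
    nlinarith

/-- The integral representation
`Γ(s + 1/2) K[s, x] = π^(1/2) (x / 2) ^ s ∫ exp (-x v) (v² - 1) ^ (s - 1/2) dv` over `1 < v`,
written in the variable `p = v² - 1`. -/
theorem two_mul_powS_mul_gammaHalf_mul_besselK {x : ℝ} (hx : 0 < x) {s : ℂ} (hs : 0 < s.re) :
    2 * (powS s x * (gammaHalf s * besselK s x)) =
      (Real.sqrt Real.pi : ℂ) * mellin (fun p => (shiftedKernel x p : ℂ)) (s + 1 / 2) := by
  have ha : 0 < (s + 1 / 2).re := by simp; linarith
  -- The rate `x / (2 t)` turns `besselKernel x t` into a kernel of the same shape, of argument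
  -- `x √(1 + p)` and order `-1/2`, for which `K` is elementary.
  let r : ℝ → ℝ := fun t => x / (2 * t)
  have hr0 : ∀ t ∈ Ioi (0 : ℝ), 0 < r t := fun t ht => by
    have : 0 < t := ht
    positivity
  let A : ℝ → ℂ := fun t => ((t : ℂ) ^ (s - 1) * (besselKernel x t : ℂ)) * (r t : ℂ) ^ (s + 1 / 2)
  have hA : ∀ t ∈ Ioi (0 : ℝ), A t * (1 / (r t : ℂ)) ^ (s + 1 / 2) =
      (t : ℂ) ^ (s - 1) • (besselKernel x t : ℂ) := by
    intro t ht
    have h := hr0 t ht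
    have h0 : (r t : ℂ) ^ (s + 1 / 2) ≠ 0 := by
      rw [Complex.cpow_ne_zero_iff]; left; exact_mod_cast h.ne'
    simp only [A]
    rw [one_div_ofReal_cpow h, mul_assoc, mul_one_div_cancel h0, mul_one, smul_eq_mul]
  have hrm : Measurable r := by fun_prop
  have hAm : AEStronglyMeasurable A (volume.restrict (Ioi 0)) := by
    refine Measurable.aestronglyMeasurable ?_
    unfold A besselKernel
    fun_prop
  have hconv := (mellinRegular_besselKernel hx).mellinConvergent hs
  have key := Gamma_mul_integral_mul_cpow ha hAm hrm hr0
    (hconv.congr_fun (fun t ht => (hA t ht).symm) measurableSet_Ioi)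
  rw [setIntegral_congr_fun measurableSet_Ioi hA] at key
  change _ * mellin (fun t => (besselKernel x t : ℂ)) s = _ at key
  rw [mellin_besselKernel hx hs] at key
  have hx2 : ((x / 2 : ℝ) : ℂ) ≠ 0 := by exact_mod_cast (half_pos hx).ne'
  have hinner : ∀ p ∈ Ioi (0 : ℝ), (p : ℂ) ^ (s + 1 / 2 - 1) *
      ∫ t in Ioi (0 : ℝ), A t * (Real.exp (-(r t * p)) : ℂ) =
      (((x / 2 : ℝ) : ℂ) ^ s * (Real.sqrt Real.pi : ℂ)) *
        ((p : ℂ) ^ (s + 1 / 2 - 1) • (shiftedKernel x p : ℂ)) := by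
    intro p hp
    have hp : 0 < p := hp
    set c := Real.sqrt (1 + p) with hc
    have hc0 : 0 < c := Real.sqrt_pos.2 (by linarith)
    have hcc : c ^ 2 = 1 + p := Real.sq_sqrt (by linarith)
    have e : ∀ t ∈ Ioi (0 : ℝ), A t * (Real.exp (-(r t * p)) : ℂ) =
        ((x / 2 : ℝ) : ℂ) ^ (s + 1 / 2) *
          ((t : ℂ) ^ (-(1 / 2 : ℂ) - 1) • (besselKernel (x * c) (c⁻¹ * t) : ℂ)) := by
      intro t ht
      have ht : 0 < t := ht
      have h1 : besselKernel x t * Real.exp (-(r t * p)) = besselKernel (x * c) (c⁻¹ * t) := by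
        simp only [besselKernel, r, ← Real.exp_add]
        congr 1
        field_simp
        rw [hcc]
        ring
      have h2 : (t : ℂ) ^ (s - 1) * (r t : ℂ) ^ (s + 1 / 2) =
          ((x / 2 : ℝ) : ℂ) ^ (s + 1 / 2) * (t : ℂ) ^ (-(1 / 2 : ℂ) - 1) := by
        have h3 : (r t : ℂ) ^ (s + 1 / 2) =
            ((x / 2 : ℝ) : ℂ) ^ (s + 1 / 2) * (1 / (t : ℂ)) ^ (s + 1 / 2) := by
          rw [← Complex.ofReal_one, ← Complex.ofReal_div,
            ← Complex.mul_cpow_ofReal_nonneg (by positivity) (by positivity), ← Complex.ofReal_mul]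
          congr 2
          simp only [r]
          field_simp
        have ht0 : (t : ℂ) ≠ 0 := by exact_mod_cast ht.ne'
        rw [h3, one_div_ofReal_cpow ht, show s - 1 = (-(1 / 2 : ℂ) - 1) + (s + 1 / 2) by ring,
          Complex.cpow_add _ _ ht0]
        have : (t : ℂ) ^ (s + 1 / 2) ≠ 0 := by
          rw [Complex.cpow_ne_zero_iff]; left; exact ht0
        linear_combination (((x / 2 : ℝ) : ℂ) ^ (s + 1 / 2) * (t : ℂ) ^ (-(1 / 2 : ℂ) - 1)) *
          mul_one_div_cancel this
      rw [← h1, smul_eq_mul]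
      simp only [A]
      push_cast at h2 ⊢
      linear_combination ((besselKernel x t : ℂ) * Complex.exp (-(r t * p))) * h2
    have hsq : ((x / 2 : ℝ) : ℂ) ^ (1 / 2 : ℂ) * (((c⁻¹ : ℝ) : ℂ) ^ (1 / 2 : ℂ) *
        (2 * ((Real.sqrt (Real.pi / (2 * (x * c))) : ℝ) : ℂ))) =
        (Real.sqrt Real.pi : ℂ) / c := by
      have hh : ∀ y : ℝ, 0 ≤ y → (y : ℂ) ^ (1 / 2 : ℂ) = (Real.sqrt y : ℂ) := by
        intro y hy
        rw [Real.sqrt_eq_rpow, Complex.ofReal_cpow hy]; push_cast; rfl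
      rw [hh _ (by positivity), hh _ (by positivity)]
      norm_cast
      have : Real.sqrt (x / 2) * (Real.sqrt c⁻¹ * (2 * Real.sqrt (Real.pi / (2 * (x * c))))) =
          2 * (Real.sqrt (x / 2) * (Real.sqrt c⁻¹ * Real.sqrt (Real.pi / (2 * (x * c))))) := by ring
      rw [this, ← Real.sqrt_mul (by positivity), ← Real.sqrt_mul (by positivity),
        show x / 2 * (c⁻¹ * (Real.pi / (2 * (x * c)))) = Real.pi / (2 * c) ^ 2 by field_simp,
        Real.sqrt_div Real.pi_pos.le, Real.sqrt_sq (by positivity)]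
      field_simp
    rw [setIntegral_congr_fun measurableSet_Ioi e, integral_const_mul]
    change _ * (_ * mellin (fun t => (besselKernel (x * c) (c⁻¹ * t) : ℂ)) (-(1 / 2 : ℂ))) = _
    rw [mellin_comp_mul_left (fun t => (besselKernel (x * c) t : ℂ)) _ (inv_pos.2 hc0),
      mellin_besselKernel_inv, mellin_besselKernel (by positivity) (by norm_num),
      besselK_one_half, neg_neg, Complex.cpow_add _ _ hx2, smul_eq_mul, smul_eq_mul, shiftedKernel,
      ← hc, ← neg_mul]
    push_cast at hsq ⊢
    linear_combination ((p : ℂ) ^ (s + 1 / 2 - 1) * ((x : ℂ) / 2) ^ s * Complex.exp (-x * c)) * hsq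
  rw [setIntegral_congr_fun measurableSet_Ioi hinner, integral_const_mul] at key
  change _ = _ * mellin (fun p => (shiftedKernel x p : ℂ)) (s + 1 / 2) at key
  have hS : powS s x * ((x / 2 : ℝ) : ℂ) ^ s = 1 := by
    rw [powS, ← Complex.mul_cpow_ofReal_nonneg (by positivity) (by positivity),
      ← Complex.ofReal_mul, show 2 / x * (x / 2) = 1 by field_simp, Complex.ofReal_one,
      Complex.one_cpow]
  rw [gammaHalf]
  linear_combination powS s x * key + (Real.sqrt Real.pi : ℂ) *
    mellin (fun p => (shiftedKernel x p : ℂ)) (s + 1 / 2) * hS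

/-- `K` eliminated between its two integral representations. This expresses `T` through a Laplace
integral without oscillation. -/
theorem besselT_mul_sq {x : ℝ} (hx : 0 < x) {s : ℂ} (hs : 0 < s.re) :
    besselT s x * ((powS s x * gammaHalf s) * (powS s x * gammaHalf s)) =
      (Real.pi / 2 : ℂ) * mellin (fun p => (shiftedKernel x p : ℂ)) (s + 1 / 2) := by
  have h1 := powS_mul_gammaHalf_mul_besselT hx hs
  have h2 := two_mul_powS_mul_gammaHalf_mul_besselK hx hs
  have h3 : (Real.sqrt Real.pi : ℂ) * Real.sqrt Real.pi = Real.pi := by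
    exact_mod_cast Real.mul_self_sqrt Real.pi_pos.le
  linear_combination (powS s x * gammaHalf s) * h1 + ((Real.sqrt Real.pi : ℂ) / 2) * h2 +
    mellin (fun p => (shiftedKernel x p : ℂ)) (s + 1 / 2) / 2 * h3

end BesselRelations

/-! ### Laplace integrals of logarithms -/

section LaplaceIntegrals

open Filter Topology

theorem mellinRegular_exp_mul_log_add_two {x : ℝ} (hx : 0 < x) (a ε : ℕ) :
    MellinRegular (fun u : ℝ =>
      ((Real.exp (-x * u) * (Real.log (u + 2) ^ a / (u + 2) ^ ε) : ℝ) : ℂ)) := by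
  have hnorm : ∀ u : ℝ, 0 < u →
      ‖((Real.exp (-x * u) * (Real.log (u + 2) ^ a / (u + 2) ^ ε) : ℝ) : ℂ)‖ ≤
        Real.exp (-x * u) * (u + 2) ^ a := by
    intro u hu
    have h0 : 0 ≤ Real.log (u + 2) := Real.log_nonneg (by linarith)
    rw [Complex.norm_real, Real.norm_of_nonneg (by positivity)]
    gcongr
    refine (div_le_self (by positivity) (one_le_pow₀ (by linarith))).trans ?_
    gcongr
    linarith [Real.log_le_sub_one_of_pos (show 0 < u + 2 by linarith)]
  refine .of_continuousOn ?_ (fun b => ?_) ?_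
  · refine Complex.continuous_ofReal.comp_continuousOn ?_
    have h2 : ∀ u ∈ Ioi (0 : ℝ), u + 2 ≠ 0 := fun u hu => by
      have : 0 < u := hu
      positivity
    refine ContinuousOn.mul (by fun_prop) (ContinuousOn.div ?_ (by fun_prop) fun u hu =>
      pow_ne_zero _ (h2 u hu))
    exact (ContinuousOn.log (by fun_prop) h2).pow a
  · have h1 : (fun u : ℝ => ((Real.exp (-x * u) * (Real.log (u + 2) ^ a / (u + 2) ^ ε) : ℝ) : ℂ))
        =O[atTop] fun u : ℝ => Real.exp (-x * u) * u ^ (a : ℝ) := by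
      refine Asymptotics.IsBigO.of_bound (2 ^ a) ?_
      filter_upwards [eventually_ge_atTop 2] with u hu
      refine (hnorm u (by linarith)).trans ?_
      have hu0 : 0 ≤ u := by linarith
      rw [Real.norm_of_nonneg (by positivity), Real.rpow_natCast]
      calc _ ≤ Real.exp (-x * u) * (2 * u) ^ a := by gcongr; linarith
        _ = _ := by rw [mul_pow]; ring
    have h2 := (isLittleO_exp_neg_mul_rpow_atTop hx (-b - a)).isBigO.mul
      (Asymptotics.isBigO_refl (fun u : ℝ => u ^ (a : ℝ)) atTop)
    refine (h1.trans h2).congr' EventuallyEq.rfl ?_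
    filter_upwards [eventually_gt_atTop 0] with u hu
    simp only [← Real.rpow_add hu]
    ring_nf
  · refine Asymptotics.IsBigO.of_bound (3 ^ a) ?_
    filter_upwards [Ioo_mem_nhdsGT (zero_lt_one' ℝ)] with u hu
    refine (hnorm u hu.1).trans ?_
    have hu0 := hu.1
    rw [norm_one, mul_one]
    have h1 : Real.exp (-x * u) ≤ 1 := Real.exp_le_one_iff.2 (by nlinarith)
    calc _ ≤ 1 * (3 : ℝ) ^ a := by gcongr; linarith [hu.2]
      _ = _ := one_mul _

theorem integrableOn_logIntegrand {x : ℝ} (hx : 0 < x) (a b ε : ℕ) : IntegrableOn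
    (fun u : ℝ => Real.exp (-x * u) * (Real.log (u + 2) ^ a * Real.log u ^ b / (u + 2) ^ ε))
    (Ioi 0) := by
  have h := ((mellinRegular_exp_mul_log_add_two hx a ε).log_pow_mul b).integrableOn.re
  refine h.congr (ae_of_all _ fun u => ?_)
  simp only [← Complex.ofReal_pow, ← Complex.ofReal_mul]
  rw [RCLike.re_eq_complex_re, Complex.ofReal_re]
  ring

/-- The logarithmic Laplace integrals are derivatives at `1` of the Mellin transform
`x ^ (-s) Γ(s)` of `exp (-x u)`. -/
theorem ofReal_logIntegral_zero_zero (b : ℕ) (x : ℝ) :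
    (logIntegral 0 b 0 x : ℂ) =
      mellin (fun u => (Real.log u : ℂ) ^ b * (Real.exp (-x * u) : ℂ)) 1 := by
  rw [logIntegral, mellin, ← integral_complex_ofReal]
  congr 1
  funext u
  simp [mul_comm]

theorem mellin_exp_neg_mul {x : ℝ} (hx : 0 < x) {s : ℂ} (hs : 0 < s.re) :
    mellin (fun u : ℝ => (Real.exp (-x * u) : ℂ)) s = ((1 / x : ℝ) : ℂ) ^ s * Complex.Gamma s := by
  have := Complex.integral_cpow_mul_exp_neg_mul_Ioi hs hx
  push_cast
  rw [← this, mellin]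
  simp

theorem mellinRegular_exp_neg_mul {x : ℝ} (hx : 0 < x) :
    MellinRegular (fun u : ℝ => (Real.exp (-x * u) : ℂ)) := by
  simpa using mellinRegular_exp_mul_log_add_two hx 0 0

theorem mul_logIntegral_zero_zero_zero {x : ℝ} (hx : 0 < x) : x * logIntegral 0 0 0 x = 1 := by
  have h := ofReal_logIntegral_zero_zero 0 x
  simp only [pow_zero, one_mul] at h
  rw [mellin_exp_neg_mul hx (by simp), Complex.Gamma_one, Complex.cpow_one, mul_one] at h
  rw [Complex.ofReal_injective h]
  field_simp

/-- Integration by parts. -/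
theorem mul_logIntegral_succ {x : ℝ} (hx : 0 < x) (k : ℕ) :
    x * logIntegral (k + 1) 0 0 x = Real.log 2 ^ (k + 1) + (k + 1) * logIntegral k 0 1 x := by
  have i1 := integrableOn_logIntegrand hx (k + 1) 0 0
  have i2 := integrableOn_logIntegrand hx k 0 1
  let f : ℝ → ℝ := fun u => Real.exp (-x * u) * Real.log (u + 2) ^ (k + 1)
  let f' : ℝ → ℝ := fun u =>
    (k + 1) * (Real.exp (-x * u) * (Real.log (u + 2) ^ k * Real.log u ^ 0 / (u + 2) ^ 1)) -
    x * (Real.exp (-x * u) * (Real.log (u + 2) ^ (k + 1) * Real.log u ^ 0 / (u + 2) ^ 0))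
  have hd : ∀ u ∈ Ici (0 : ℝ), HasDerivAt f (f' u) u := by
    intro u hu
    have hu : 0 ≤ u := hu
    have h1 : HasDerivAt (fun u : ℝ => Real.exp (-x * u)) (Real.exp (-x * u) * (-x * 1)) u :=
      ((hasDerivAt_id u).const_mul (-x)).exp
    have h2 : HasDerivAt (fun u : ℝ => Real.log (u + 2)) (1 / (u + 2)) u :=
      ((hasDerivAt_id u).add_const 2).log (by positivity)
    refine (h1.mul (h2.fun_pow (k + 1))).congr_deriv ?_
    simp only [f', Nat.add_sub_cancel]
    push_cast
    ring
  have hf' : IntegrableOn f' (Ioi 0) := (i2.const_mul _).sub (i1.const_mul _)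
  have hf : IntegrableOn f (Ioi 0) := i1.congr (ae_of_all _ fun u => by simp [f])
  have ht := tendsto_zero_of_hasDerivAt_of_integrableOn_Ioi
    (fun u hu => hd u (Ioi_subset_Ici_self hu)) hf' hf
  have key := integral_Ioi_of_hasDerivAt_of_tendsto' hd hf' ht
  have e : ∫ u in Ioi (0 : ℝ), f' u =
      (k + 1) * logIntegral k 0 1 x - x * logIntegral (k + 1) 0 0 x := by
    simp only [f']
    rw [integral_sub (i2.const_mul _) (i1.const_mul _), integral_const_mul, integral_const_mul]
    rfl
  rw [e] at key
  simp only [f, mul_zero, Real.exp_zero, zero_add, one_mul] at key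
  linarith

theorem expIntegral_eq_logIntegral {x : ℝ} (hx : 0 < x) : expIntegral x = logIntegral 0 0 1 x := by
  have h := integral_comp_mul_left_Ioi (fun u => Real.exp (-u) / (u + 2 * x)) 0 hx
  rw [mul_zero, smul_eq_mul] at h
  rw [expIntegral, ← mul_inv_cancel_left₀ hx.ne' (∫ u in Ioi (0 : ℝ), _), ← h,
    ← integral_const_mul, logIntegral]
  refine setIntegral_congr_fun measurableSet_Ioi fun u hu => ?_
  have hu : 0 < u := hu
  simp only [pow_zero, mul_one, pow_one]
  rw [neg_mul]
  field_simp

theorem integrableOn_exp_neg_div {x : ℝ} (hx : 0 < x) :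
    IntegrableOn (fun u : ℝ => Real.exp (-u) / (u + 2 * x)) (Ioi 0) := by
  have h := integrableOn_Ioi_comp_mul_left_iff (fun u => Real.exp (-u) / (u + 2 * x)) 0 hx
  rw [mul_zero] at h
  rw [← h]
  refine IntegrableOn.congr_fun (f := fun u => x⁻¹ * (Real.exp (-x * u) *
    (Real.log (u + 2) ^ 0 * Real.log u ^ 0 / (u + 2) ^ 1)))
    ((integrableOn_logIntegrand hx 0 0 1).const_mul x⁻¹) (fun u hu => ?_) measurableSet_Ioi
  have hu : 0 < u := hu
  simp only [pow_zero, mul_one, pow_one]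
  rw [neg_mul]
  field_simp

/-- With the factor `exp (-2 x)` the phase becomes `x (u + 2)`, and differentiation cancels the
denominator `u + 2`. -/
theorem hasDerivAt_exp_mul_logIntegral {x : ℝ} (hx : 0 < x) (a b : ℕ) :
    HasDerivAt (fun y : ℝ => Real.exp (-2 * y) * logIntegral a b 1 y)
      (-(Real.exp (-2 * x) * logIntegral a b 0 x)) x := by
  set μ := volume.restrict (Ioi (0 : ℝ)) with hμ
  have hL0 : ∀ᵐ u ∂μ, 0 ≤ u + 2 := by
    filter_upwards [ae_restrict_mem measurableSet_Ioi] with u hu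
    have : 0 < u := hu
    positivity
  let g : ℝ → ℂ := fun u => ((Real.log (u + 2) ^ a * Real.log u ^ b / (u + 2) ^ 1 : ℝ) : ℂ)
  have hsplit : ∀ y u : ℝ, Real.exp (-y * (u + 2)) = Real.exp (-2 * y) * Real.exp (-y * u) := by
    intro y u
    rw [← Real.exp_add]
    ring_nf
  have hg : ∀ σ : ℝ, 0 < σ → Integrable (fun u => g u * (Real.exp (-σ * (u + 2)) : ℂ)) μ := by
    intro σ hσ
    refine ((integrableOn_logIntegrand hσ a b 1).const_mul (Real.exp (-2 * σ))).ofReal.congr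
      (ae_of_all _ fun u => ?_)
    have : Real.exp (-2 * σ) * (Real.exp (-σ * u) *
        (Real.log (u + 2) ^ a * Real.log u ^ b / (u + 2) ^ 1)) =
        (Real.log (u + 2) ^ a * Real.log u ^ b / (u + 2) ^ 1) * Real.exp (-σ * (u + 2)) := by
      rw [hsplit]
      ring
    exact (congrArg Complex.ofReal this).trans (Complex.ofReal_mul _ _)
  have key := (hasDerivAt_integral_mul_cexp (μ := μ) (g := g) (L := fun u => u + 2)
    (by fun_prop) hL0 hg (s := (x : ℂ)) (by simpa using hx)).real_of_complex
  have e1 : ∀ y : ℝ, ∫ u, g u * Complex.exp (-(y : ℂ) * ((u + 2 : ℝ) : ℂ)) ∂μ =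
      ((Real.exp (-2 * y) * logIntegral a b 1 y : ℝ) : ℂ) := by
    intro y
    rw [logIntegral, ← integral_const_mul, ← integral_complex_ofReal]
    congr 1
    funext u
    rw [← Complex.ofReal_neg, ← Complex.ofReal_mul, ← Complex.ofReal_exp, hsplit]
    simp only [g]
    norm_cast
    ring
  have e2 : ∫ u, (-((u + 2 : ℝ) : ℂ) * g u) * Complex.exp (-(x : ℂ) * ((u + 2 : ℝ) : ℂ)) ∂μ =
      ((-(Real.exp (-2 * x) * logIntegral a b 0 x) : ℝ) : ℂ) := by
    rw [← neg_mul, logIntegral, ← integral_const_mul, ← integral_complex_ofReal]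
    refine setIntegral_congr_fun measurableSet_Ioi fun u hu => ?_
    have hu : 0 < u := hu
    rw [← Complex.ofReal_neg x, ← Complex.ofReal_mul, ← Complex.ofReal_exp, hsplit]
    simp only [g]
    norm_cast
    simp only [pow_zero, pow_one]
    field_simp
  simpa only [e1, e2, Complex.ofReal_re] using key

theorem isBigO_logIntegral (a b ε : ℕ) :
    (fun y => logIntegral a b ε y) =O[atTop] (fun _ => (1 : ℝ)) := by
  refine Asymptotics.IsBigO.of_bound (∫ u in Ioi (0 : ℝ),
    ‖Real.exp (-1 * u) * (Real.log (u + 2) ^ a * Real.log u ^ b / (u + 2) ^ ε)‖) ?_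
  filter_upwards [eventually_ge_atTop 1] with y hy
  rw [norm_one, mul_one]
  refine norm_integral_le_of_norm_le (integrableOn_logIntegrand one_pos a b ε).norm ?_
  filter_upwards [ae_restrict_mem measurableSet_Ioi] with u hu
  have hu : 0 < u := hu
  rw [norm_mul, norm_mul, Real.norm_of_nonneg (Real.exp_pos _).le,
    Real.norm_of_nonneg (Real.exp_pos _).le]
  gcongr



theorem iteratedDeriv_ofReal_cpow_div {c : ℝ} (hc : 0 < c) (n : ℕ) (a : ℂ) :
    iteratedDeriv n (fun s : ℂ => (c : ℂ) ^ s) a / (c : ℂ) ^ a = (Real.log c : ℂ) ^ n := by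
  have hc0 : (c : ℂ) ≠ 0 := by exact_mod_cast hc.ne'
  have e : (fun s : ℂ => (c : ℂ) ^ s) = fun s => Complex.exp ((Real.log c : ℂ) * s) := by
    funext s
    rw [Complex.cpow_def_of_ne_zero hc0, Complex.ofReal_log hc.le]
  have h0 : (c : ℂ) ^ a ≠ 0 := by
    rw [Complex.cpow_ne_zero_iff]; exact Or.inl hc0
  have hv := congrFun e a
  rw [div_eq_iff h0, e, iteratedDeriv_cexp_const_mul, hv]

theorem analyticAt_ofReal_cpow {c : ℝ} (hc : 0 < c) (a : ℂ) :
    AnalyticAt ℂ (fun s : ℂ => (c : ℂ) ^ s) a := by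
  refine AnalyticAt.cpow analyticAt_const analyticAt_id ?_
  exact Complex.ofReal_mem_slitPlane.2 hc

theorem analyticAt_Gamma {s : ℂ} (hs : 0 < s.re) : AnalyticAt ℂ Complex.Gamma s := by
  have ho : IsOpen {z : ℂ | 0 < z.re} := isOpen_lt continuous_const Complex.continuous_re
  refine DifferentiableOn.analyticAt (s := {z : ℂ | 0 < z.re}) (fun z hz => ?_) (ho.mem_nhds hs)
  refine (Complex.differentiableAt_Gamma z fun m hm => ?_).differentiableWithinAt
  have hz : 0 < z.re := hz
  rw [hm] at hz
  simp at hz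
  have : (0 : ℝ) ≤ m := m.cast_nonneg
  linarith

theorem mellin_exp_neg_mul_eventuallyEq {x : ℝ} (hx : 0 < x) :
    mellin (fun u : ℝ => (Real.exp (-x * u) : ℂ)) =ᶠ[𝓝 1]
      fun s => ((1 / x : ℝ) : ℂ) ^ s * Complex.Gamma s := by
  have ho : IsOpen {z : ℂ | 0 < z.re} := isOpen_lt continuous_const Complex.continuous_re
  filter_upwards [ho.mem_nhds (by simp : (0 : ℝ) < (1 : ℂ).re)] with s hs
  exact mellin_exp_neg_mul hx hs

theorem mul_logIntegral_zero_one {x : ℝ} (hx : 0 < x) :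
    (x : ℂ) * (logIntegral 0 1 0 x : ℂ) = deriv Complex.Gamma 1 - (Real.log x : ℂ) := by
  have hc : 0 < 1 / x := by positivity
  have hc0 : ((1 / x : ℝ) : ℂ) ≠ 0 := by exact_mod_cast hc.ne'
  have hx0 : (x : ℂ) ≠ 0 := by exact_mod_cast hx.ne'
  have h1 := ((mellinRegular_exp_neg_mul hx).hasDerivAt_mellin (s := 1) (by simp)).deriv
  have h2 := deriv_mul_div (analyticAt_ofReal_cpow hc 1) (analyticAt_Gamma (s := 1) (by simp))
    (by rwa [Complex.cpow_one]) (by simp)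
  rw [← (mellin_exp_neg_mul_eventuallyEq hx).deriv_eq, h1,
    ← iteratedDeriv_one (f := fun s : ℂ => _ ^ s), iteratedDeriv_ofReal_cpow_div hc,
    Complex.Gamma_one, Complex.cpow_one] at h2
  rw [ofReal_logIntegral_zero_zero]
  simp only [Complex.real_smul] at h2
  simp only [pow_one]
  rw [one_div, Real.log_inv] at h2
  push_cast at h2 ⊢
  simp only [neg_mul] at h2 ⊢
  field_simp at h2
  linear_combination h2

theorem mul_logIntegral_zero_two {x : ℝ} (hx : 0 < x) :
    (x : ℂ) * (logIntegral 0 2 0 x : ℂ) =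
      iteratedDeriv 2 Complex.Gamma 1 - 2 * (Real.log x : ℂ) * deriv Complex.Gamma 1
        + (Real.log x : ℂ) ^ 2 := by
  have hc : 0 < 1 / x := by positivity
  have hc0 : ((1 / x : ℝ) : ℂ) ≠ 0 := by exact_mod_cast hc.ne'
  have hx0 : (x : ℂ) ≠ 0 := by exact_mod_cast hx.ne'
  have h1 := (mellinRegular_exp_neg_mul hx).iteratedDeriv_two_mellin (s := 1) (by simp)
  have h2 := iteratedDeriv_two_mul_div (analyticAt_ofReal_cpow hc 1)
    (analyticAt_Gamma (s := 1) (by simp)) (by rwa [Complex.cpow_one]) (by simp)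
  rw [← (mellin_exp_neg_mul_eventuallyEq hx).iteratedDeriv_eq, h1,
    ← iteratedDeriv_one (f := fun s : ℂ => _ ^ s), iteratedDeriv_ofReal_cpow_div hc,
    iteratedDeriv_ofReal_cpow_div hc, Complex.Gamma_one, Complex.cpow_one] at h2
  rw [ofReal_logIntegral_zero_zero]
  rw [one_div, Real.log_inv] at h2
  push_cast at h2 ⊢
  simp only [neg_mul] at h2 ⊢
  field_simp at h2
  linear_combination h2

/-- The identity that trades `log x · E(x)` for integrals with logarithms.
Both sides, multiplied by `exp (-2 x)`, vanish at infinity and have the same derivative. -/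
theorem logIntegral_add_logIntegral {x : ℝ} (hx : 0 < x) :
    logIntegral 1 0 1 x + logIntegral 0 1 1 x =
      (Real.log 2 - Real.log x - Real.eulerMascheroniConstant) * logIntegral 0 0 1 x := by
  let D : ℝ → ℝ := fun y => Real.exp (-2 * y) * logIntegral 1 0 1 y +
    Real.exp (-2 * y) * logIntegral 0 1 1 y +
    (Real.log y - Real.log 2 + Real.eulerMascheroniConstant) *
      (Real.exp (-2 * y) * logIntegral 0 0 1 y)
  have hD : ∀ y ∈ Ioi (0 : ℝ), HasDerivAt D 0 y := by
    intro y hy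
    have hy : 0 < y := hy
    have h10 := hasDerivAt_exp_mul_logIntegral hy 1 0
    have h01 := hasDerivAt_exp_mul_logIntegral hy 0 1
    have h00 := hasDerivAt_exp_mul_logIntegral hy 0 0
    have hlog : HasDerivAt (fun y => Real.log y - Real.log 2 + Real.eulerMascheroniConstant)
        y⁻¹ y := ((Real.hasDerivAt_log hy.ne').sub_const _).add_const _
    refine ((h10.add h01).add (hlog.mul h00)).congr_deriv ?_
    have e1 := mul_logIntegral_succ hy 0
    have e2 : y * logIntegral 0 1 0 y = -Real.eulerMascheroniConstant - Real.log y := by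
      have := mul_logIntegral_zero_one hy
      rw [Complex.hasDerivAt_Gamma_one.deriv] at this
      exact_mod_cast this
    have e3 := mul_logIntegral_zero_zero_zero hy
    simp only [zero_add, pow_one, Nat.cast_zero, one_mul] at e1
    field_simp
    linear_combination Real.exp (-(2 * y)) * (-e1 - e2 -
      (Real.log y - Real.log 2 + Real.eulerMascheroniConstant) * e3)
  have hexp : Tendsto (fun y : ℝ => Real.exp (-2 * y)) atTop (𝓝 0) :=
    Real.tendsto_exp_atBot.comp (tendsto_id.const_mul_atTop_of_neg (by norm_num))
  have hlogexp : Tendsto (fun y : ℝ => Real.log y * Real.exp (-2 * y)) atTop (𝓝 0) := by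
    have h := (Real.isLittleO_log_id_atTop.isBigO.mul
      (isLittleO_exp_neg_mul_rpow_atTop (a := 2) (by norm_num) (-2)).isBigO)
    refine h.trans_tendsto ((tendsto_rpow_neg_atTop one_pos).congr' ?_)
    filter_upwards [eventually_gt_atTop 0] with y hy
    rw [id, ← Real.rpow_one_add' hy.le (by norm_num)]
    norm_num
  have hmul : ∀ {f : ℝ → ℝ} (a b ε : ℕ), Tendsto f atTop (𝓝 0) →
      Tendsto (fun y => f y * logIntegral a b ε y) atTop (𝓝 0) := by
    intro f a b ε hf
    refine (((Asymptotics.isBigO_refl f atTop).mul (isBigO_logIntegral a b ε))).trans_tendsto ?_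
    simpa using hf
  have hlim : Tendsto D atTop (𝓝 0) := by
    have h := ((hmul 1 0 1 hexp).add (hmul 0 1 1 hexp)).add ((hmul 0 0 1 hlogexp).add
      ((hmul 0 0 1 hexp).const_mul (Real.eulerMascheroniConstant - Real.log 2)))
    simp only [mul_zero, add_zero] at h
    refine h.congr fun y => ?_
    simp only [D]
    ring
  have hconst : ∀ y ∈ Ioi (0 : ℝ), D y = D x := fun y hy =>
    isOpen_Ioi.is_const_of_deriv_eq_zero isPreconnected_Ioi
      (fun z hz => (hD z hz).differentiableAt.differentiableWithinAt)
      (fun z hz => (hD z hz).deriv) hy hx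
  have h0 : D x = 0 := by
    refine tendsto_nhds_unique (tendsto_const_nhds.congr' ?_) hlim
    filter_upwards [eventually_gt_atTop 0] with y hy
    exact (hconst y hy).symm
  have h1 : Real.exp (-2 * x) * (logIntegral 1 0 1 x + logIntegral 0 1 1 x -
      (Real.log 2 - Real.log x - Real.eulerMascheroniConstant) * logIntegral 0 0 1 x) = 0 := by
    rw [← h0]
    ring
  have := (mul_eq_zero.1 h1).resolve_left (Real.exp_pos _).ne'
  linarith

end LaplaceIntegrals

/-! ### The second derivative of the Gamma function at one -/

section DerivativesOfT

open Filter Topology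

/-- The second Taylor coefficient at `0` of the reflection formula
`Γ(1 + z) Γ(1 - z) sin (π z) = π z`. -/
theorem two_mul_iteratedDeriv_two_Gamma_one :
    2 * iteratedDeriv 2 Complex.Gamma 1 - 2 * deriv Complex.Gamma 1 ^ 2 - 2 * riemannZeta 2
      = 0 := by
  let f : ℂ → ℂ := fun z => Complex.Gamma (1 + z) * Complex.Gamma (1 - z)
  let g : ℂ → ℂ := fun z => Complex.sin (Real.pi * z)
  have hG : AnalyticAt ℂ Complex.Gamma 1 := analyticAt_Gamma (by simp)
  have hA : AnalyticAt ℂ (fun z : ℂ => Complex.Gamma (1 + z)) 0 :=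
    AnalyticAt.comp (by simpa using hG) (by fun_prop)
  have hB : AnalyticAt ℂ (fun z : ℂ => Complex.Gamma (1 - z)) 0 :=
    AnalyticAt.comp (by simpa using hG) (by fun_prop)
  have hf : AnalyticAt ℂ f 0 := hA.mul hB
  have hg : AnalyticAt ℂ g 0 := by fun_prop
  have hfg : (fun z => f z * g z) =ᶠ[𝓝 0] fun z => (Real.pi : ℂ) * z := by
    filter_upwards [Metric.ball_mem_nhds (0 : ℂ) one_pos] with z hz
    rcases eq_or_ne z 0 with rfl | h0
    · simp [f, g]
    have hs : g z ≠ 0 := by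
      simp only [g]
      rw [Complex.sin_ne_zero_iff]
      intro k hk
      have hpi : (Real.pi : ℂ) ≠ 0 := by exact_mod_cast Real.pi_ne_zero
      have hzk : z = k := mul_left_cancel₀ hpi (by rw [hk, mul_comm])
      rw [hzk, mem_ball_zero_iff, Complex.norm_intCast] at hz
      have hk0 : k = 0 := by
        rw [← Int.abs_lt_one_iff]
        exact_mod_cast hz
      exact h0 (by rw [hzk, hk0, Int.cast_zero])
    simp only [f]
    rw [add_comm, Complex.Gamma_add_one z h0, mul_assoc z, Complex.Gamma_mul_Gamma_one_sub]
    change z * (Real.pi / g z) * g z = _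
    field_simp
  -- `sin (π z)` vanishes to first order at `0`, so the third derivative of the product is needed to
  -- see the second derivative of `f`.
  have h3 := hfg.iteratedDeriv_eq 3
  have hg' : ∀ n, iteratedDeriv n g 0 = (Real.pi : ℂ) ^ n * iteratedDeriv n Complex.sin 0 := by
    intro n
    have := congrFun (iteratedDeriv_comp_const_mul (n := n) (f := Complex.sin)
      Complex.contDiff_sin (Real.pi : ℂ)) 0
    simpa using this
  have hs1 : iteratedDeriv 1 Complex.sin 0 = 1 := by simp [iteratedDeriv_one]
  have hs2 : iteratedDeriv 2 Complex.sin 0 = 0 := by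
    rw [Complex.iteratedDeriv_even_sin 1]; simp
  have hs3 : iteratedDeriv 3 Complex.sin 0 = -1 := by
    rw [Complex.iteratedDeriv_odd_sin 1]; simp
  rw [iteratedDeriv_fun_mul hf.contDiffAt hg.contDiffAt] at h3
  have hlin : iteratedDeriv 3 (fun z : ℂ => (Real.pi : ℂ) * z) 0 = 0 := by
    rw [iteratedDeriv_const_mul_field, iteratedDeriv_fun_id]
    simp
  rw [hlin] at h3
  simp only [Finset.sum_range_succ, Finset.sum_range_zero, hg'] at h3
  norm_num [Nat.choose, hs1, hs2, hs3] at h3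
  have hf0 : f 0 = 1 := by simp [f]
  have hpi : (Real.pi : ℂ) ≠ 0 := by exact_mod_cast Real.pi_ne_zero
  have hf2 : iteratedDeriv 2 f 0 =
      2 * iteratedDeriv 2 Complex.Gamma 1 - 2 * deriv Complex.Gamma 1 ^ 2 := by
    have h := iteratedDeriv_two_mul_div hA hB (by simp) (by simp)
    have dA : deriv (fun z : ℂ => Complex.Gamma (1 + z)) 0 = deriv Complex.Gamma 1 := by
      rw [← iteratedDeriv_one, iteratedDeriv_comp_const_add]; simp [iteratedDeriv_one]
    have dB : deriv (fun z : ℂ => Complex.Gamma (1 - z)) 0 = -deriv Complex.Gamma 1 := by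
      rw [← iteratedDeriv_one, iteratedDeriv_comp_const_sub]; simp [iteratedDeriv_one]
    rw [dA, dB, iteratedDeriv_comp_const_add, iteratedDeriv_comp_const_sub] at h
    simp at h
    rw [h]
    ring
  rw [riemannZeta_two, ← hf2]
  rw [hf0] at h3
  have : (Real.pi : ℂ) * (3 * iteratedDeriv 2 f 0 - Real.pi ^ 2) = 0 := by
    linear_combination h3
  have := (mul_eq_zero.1 this).resolve_left hpi
  linear_combination this / 3

/-! ### The derivatives of the cosine transform as integrals -/

section CosineTransform

/-- The part of the integrand of `T` that does not depend on the order: the integrand of `T[s, x]`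
is `cosFactor x u * exp (-s log (u² + 1))`. -/
noncomputable def cosFactor (x u : ℝ) : ℂ :=
  ((Real.cos (x * u) * Real.exp (-(1 / 2) * Real.log (u ^ 2 + 1)) : ℝ) : ℂ)

theorem besselT_eq_integral_cexp (s : ℂ) (x : ℝ) : besselT s x =
    ∫ u in Ioi (0 : ℝ), cosFactor x u * Complex.exp (-s * (Real.log (u ^ 2 + 1) : ℝ)) := by
  rw [besselT]
  congr 1
  funext u
  have hu : 0 < u ^ 2 + 1 := by positivity
  have h0 : ((u ^ 2 + 1 : ℝ) : ℂ) ≠ 0 := by exact_mod_cast hu.ne'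
  rw [Complex.cpow_def_of_ne_zero h0, ← Complex.ofReal_log hu.le, div_eq_mul_inv, ← Complex.exp_neg,
    cosFactor, Complex.ofReal_mul, Complex.ofReal_exp, mul_assoc, ← Complex.exp_add]
  congr 2
  push_cast
  ring

theorem integrable_cosFactor_mul_exp (x : ℝ) (σ : ℝ) (hσ : 0 < σ) :
    Integrable (fun u => cosFactor x u * (Real.exp (-σ * Real.log (u ^ 2 + 1)) : ℂ))
      (volume.restrict (Ioi 0)) := by
  refine (integrable_one_add_sq_rpow hσ).mono' ?_ (ae_of_all _ fun u => ?_)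
  · unfold cosFactor
    exact Measurable.aestronglyMeasurable (by fun_prop)
  · have hu : 0 < u ^ 2 + 1 := by positivity
    rw [cosFactor, ← Complex.ofReal_mul, Complex.norm_real, mul_assoc, ← Real.exp_add, norm_mul,
      Real.norm_of_nonneg (Real.exp_pos _).le, Real.norm_eq_abs, Real.rpow_def_of_pos hu,
      show -(1 / 2) * Real.log (u ^ 2 + 1) + -σ * Real.log (u ^ 2 + 1) =
        Real.log (u ^ 2 + 1) * -(σ + 1 / 2) by ring]
    exact mul_le_of_le_one_left (Real.exp_pos _).le (Real.abs_cos_le_one _)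

theorem log_sq_add_one_nonneg : ∀ᵐ u ∂(volume.restrict (Ioi (0 : ℝ))), 0 ≤ Real.log (u ^ 2 + 1) :=
  ae_of_all _ fun u => Real.log_nonneg (by nlinarith [sq_nonneg u])

theorem hasDerivAt_besselT (x : ℝ) {s : ℂ} (hs : 0 < s.re) :
    HasDerivAt (fun s => besselT s x) (∫ u in Ioi (0 : ℝ),
      (-(Real.log (u ^ 2 + 1) : ℂ) * cosFactor x u) *
        Complex.exp (-s * (Real.log (u ^ 2 + 1) : ℝ))) s := by
  simp only [besselT_eq_integral_cexp]
  exact hasDerivAt_integral_mul_cexp (by fun_prop) log_sq_add_one_nonneg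
    (integrable_cosFactor_mul_exp x) hs

theorem analyticAt_besselT (x : ℝ) {s : ℂ} (hs : 0 < s.re) :
    AnalyticAt ℂ (fun s => besselT s x) s := by
  have ho : IsOpen {z : ℂ | 0 < z.re} := isOpen_lt continuous_const Complex.continuous_re
  exact DifferentiableOn.analyticAt (s := {z : ℂ | 0 < z.re})
    (fun z hz => (hasDerivAt_besselT x hz).differentiableAt.differentiableWithinAt)
    (ho.mem_nhds hs)

theorem cosFactor_mul_eq (x u : ℝ) :
    (-(Real.log (u ^ 2 + 1) : ℂ) * (-(Real.log (u ^ 2 + 1) : ℂ) * cosFactor x u)) *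
      (Real.exp (-(1 / 2) * Real.log (u ^ 2 + 1)) : ℂ) =
      ((Real.cos (x * u) * Real.log (u ^ 2 + 1) ^ 2 / (u ^ 2 + 1) : ℝ) : ℂ) := by
  have hu : 0 < u ^ 2 + 1 := by positivity
  have h : Real.exp (-(1 / 2) * Real.log (u ^ 2 + 1)) * Real.exp (-(1 / 2) * Real.log (u ^ 2 + 1)) =
      (u ^ 2 + 1)⁻¹ := by
    rw [← Real.exp_add, show -(1 / 2) * Real.log (u ^ 2 + 1) + -(1 / 2) * Real.log (u ^ 2 + 1) =
      -Real.log (u ^ 2 + 1) by ring, Real.exp_neg, Real.exp_log hu]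
  rw [cosFactor, div_eq_mul_inv (Real.cos (x * u) * _), ← h]
  push_cast
  ring

theorem integrableOn_cos_mul_log_sq (x : ℝ) : IntegrableOn
    (fun u : ℝ => Real.cos (x * u) * Real.log (u ^ 2 + 1) ^ 2 / (u ^ 2 + 1)) (Ioi 0) := by
  have h := integrable_neg_mul_mul_exp (by fun_prop) log_sq_add_one_nonneg
    (fun σ hσ => integrable_neg_mul_mul_exp (by fun_prop) log_sq_add_one_nonneg
      (integrable_cosFactor_mul_exp x) hσ) (one_half_pos (α := ℝ))
  simp only [cosFactor_mul_eq] at h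
  exact h.re

theorem iteratedDeriv_two_besselT (x : ℝ) :
    iteratedDeriv 2 (fun s : ℂ => besselT s x) (1 / 2) =
      ((∫ u in Ioi (0 : ℝ),
        Real.cos (x * u) * Real.log (u ^ 2 + 1) ^ 2 / (u ^ 2 + 1) : ℝ) : ℂ) := by
  have ho : IsOpen {z : ℂ | 0 < z.re} := isOpen_lt continuous_const Complex.continuous_re
  have hh : 0 < (1 / 2 : ℂ).re := by norm_num
  have h1 : deriv (fun s : ℂ => besselT s x) =ᶠ[𝓝 (1 / 2)] fun s => ∫ u in Ioi (0 : ℝ),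
      (-(Real.log (u ^ 2 + 1) : ℂ) * cosFactor x u) *
        Complex.exp (-s * (Real.log (u ^ 2 + 1) : ℝ)) := by
    filter_upwards [ho.mem_nhds hh] with z hz
    exact (hasDerivAt_besselT x hz).deriv
  rw [iteratedDeriv_succ, iteratedDeriv_one, h1.deriv_eq,
    (hasDerivAt_integral_mul_cexp (by fun_prop) log_sq_add_one_nonneg
      (fun σ hσ => integrable_neg_mul_mul_exp (by fun_prop) log_sq_add_one_nonneg
        (integrable_cosFactor_mul_exp x) hσ) hh).deriv, ← integral_complex_ofReal]
  congr 1
  funext u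
  rw [← cosFactor_mul_eq]
  push_cast
  rfl

end CosineTransform

/-! ### The derivatives of the Mellin transform of the shifted kernel as Laplace integrals -/

theorem image_sq_add_two_mul_Ioi : (fun u : ℝ => u ^ 2 + 2 * u) '' Ioi 0 = Ioi 0 := by
  ext p
  constructor
  · rintro ⟨u, hu, rfl⟩
    have hu : 0 < u := hu
    exact (by positivity : 0 < u ^ 2 + 2 * u)
  · intro hp
    have hp : 0 < p := hp
    have h1 : 1 < Real.sqrt (1 + p) := Real.lt_sqrt_of_sq_lt (by linarith)
    refine ⟨Real.sqrt (1 + p) - 1, sub_pos.2 h1, ?_⟩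
    have h2 : Real.sqrt (1 + p) ^ 2 = 1 + p := Real.sq_sqrt (by linarith)
    simp only
    linarith

/-- The substitution `p = u² + 2 u`, for which `√(1 + p) = u + 1` and
`log p = log u + log (u + 2)`. -/
theorem mellin_log_pow_mul_shiftedKernel (x : ℝ) (k : ℕ) :
    mellin (fun p => (Real.log p : ℂ) ^ k * (shiftedKernel x p : ℂ)) 1 =
      ((2 * Real.exp (-x) * ∫ u in Ioi (0 : ℝ),
        Real.exp (-x * u) * (Real.log u + Real.log (u + 2)) ^ k : ℝ) : ℂ) := by
  have hd : ∀ u ∈ Ioi (0 : ℝ), HasDerivWithinAt (fun u : ℝ => u ^ 2 + 2 * u) (2 * u + 2)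
      (Ioi 0) u := by
    intro u _
    have h := ((hasDerivAt_id u).pow 2).add ((hasDerivAt_id u).const_mul 2)
    refine (h.congr_deriv ?_).hasDerivWithinAt
    simp
  have hi : InjOn (fun u : ℝ => u ^ 2 + 2 * u) (Ioi 0) := by
    intro a ha b hb hab
    have ha : 0 < a := ha
    have hb : 0 < b := hb
    have h : (a - b) * (a + b + 2) = 0 := by
      simp only at hab
      linear_combination hab
    rcases mul_eq_zero.1 h with h | h <;> linarith
  have key := integral_image_eq_integral_abs_deriv_smul measurableSet_Ioi hd hi
    (fun p => Real.log p ^ k * shiftedKernel x p)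
  rw [image_sq_add_two_mul_Ioi] at key
  have e : ∀ u ∈ Ioi (0 : ℝ), |2 * u + 2| • (Real.log (u ^ 2 + 2 * u) ^ k *
      shiftedKernel x (u ^ 2 + 2 * u)) = 2 * Real.exp (-x) *
        (Real.exp (-x * u) * (Real.log u + Real.log (u + 2)) ^ k) := by
    intro u hu
    have hu : 0 < u := hu
    rw [shiftedKernel, show 1 + (u ^ 2 + 2 * u) = (u + 1) ^ 2 by ring,
      Real.sqrt_sq (by positivity), show u ^ 2 + 2 * u = u * (u + 2) by ring,
      Real.log_mul hu.ne' (by positivity), abs_of_pos (by positivity), smul_eq_mul,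
      show -x * (u + 1) = -x + -x * u by ring, Real.exp_add]
    field_simp
  rw [setIntegral_congr_fun measurableSet_Ioi e, integral_const_mul] at key
  rw [← key, mellin, ← integral_complex_ofReal]
  congr 1
  funext p
  simp

theorem integral_exp_mul_log_add_log {x : ℝ} (hx : 0 < x) :
    ∫ u in Ioi (0 : ℝ), Real.exp (-x * u) * (Real.log u + Real.log (u + 2)) ^ 1 =
      logIntegral 0 1 0 x + logIntegral 1 0 0 x := by
  rw [logIntegral, logIntegral, ← integral_add (integrableOn_logIntegrand hx 0 1 0)
    (integrableOn_logIntegrand hx 1 0 0)]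
  congr 1
  funext u
  ring

theorem integral_exp_mul_log_add_log_sq {x : ℝ} (hx : 0 < x) :
    ∫ u in Ioi (0 : ℝ), Real.exp (-x * u) * (Real.log u + Real.log (u + 2)) ^ 2 =
      logIntegral 0 2 0 x + 2 * logIntegral 1 1 0 x + logIntegral 2 0 0 x := by
  have i1 := integrableOn_logIntegrand hx 0 2 0
  have i2 := (integrableOn_logIntegrand hx 1 1 0).const_mul 2
  have i3 := integrableOn_logIntegrand hx 2 0 0
  simp only [logIntegral]
  rw [← integral_const_mul, ← integral_add i1 i2,
    ← integral_add (μ := volume.restrict (Ioi 0)) (f := fun u =>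
    Real.exp (-x * u) * (Real.log (u + 2) ^ 0 * Real.log u ^ 2 / (u + 2) ^ 0) +
    2 * (Real.exp (-x * u) * (Real.log (u + 2) ^ 1 * Real.log u ^ 1 / (u + 2) ^ 0)))
    ((i1.add i2).congr (ae_of_all _ fun _ => rfl)) i3]
  congr 1
  funext u
  ring

end DerivativesOfT

/-! ### The expansion at order one half -/

section ValuesAtOneHalf

open Filter Topology

theorem analyticAt_powS {x : ℝ} (hx : 0 < x) (s : ℂ) : AnalyticAt ℂ (fun s => powS s x) s :=
  analyticAt_ofReal_cpow (by positivity) s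

theorem powS_ne_zero {x : ℝ} (hx : 0 < x) (s : ℂ) : powS s x ≠ 0 := by
  rw [powS, Complex.cpow_ne_zero_iff]
  left
  exact_mod_cast (by positivity : (2 / x) ≠ 0)

theorem iteratedDeriv_powS_div {x : ℝ} (hx : 0 < x) (n : ℕ) (s : ℂ) :
    iteratedDeriv n (fun s => powS s x) s / powS s x = ((Real.log 2 - Real.log x : ℝ) : ℂ) ^ n := by
  rw [← Real.log_div two_ne_zero hx.ne']
  exact iteratedDeriv_ofReal_cpow_div (by positivity) n s

theorem deriv_powS_div {x : ℝ} (hx : 0 < x) (s : ℂ) :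
    deriv (fun s => powS s x) s / powS s x = ((Real.log 2 - Real.log x : ℝ) : ℂ) := by
  simpa [iteratedDeriv_one] using iteratedDeriv_powS_div hx 1 s

theorem analyticAt_gammaHalf : AnalyticAt ℂ gammaHalf (1 / 2) :=
  AnalyticAt.comp (f := fun s : ℂ => s + 1 / 2) (analyticAt_Gamma (by norm_num)) (by fun_prop)

theorem gammaHalf_one_half : gammaHalf (1 / 2) = 1 := by
  rw [gammaHalf, add_halves, Complex.Gamma_one]

theorem gammaHalf_one_half_ne_zero : gammaHalf (1 / 2) ≠ 0 := by
  rw [gammaHalf_one_half]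
  exact one_ne_zero

theorem iteratedDeriv_gammaHalf (n : ℕ) :
    iteratedDeriv n gammaHalf (1 / 2) = iteratedDeriv n Complex.Gamma 1 := by
  unfold gammaHalf
  rw [iteratedDeriv_comp_add_const]
  simp only [add_halves]

theorem deriv_gammaHalf : deriv gammaHalf (1 / 2) = deriv Complex.Gamma 1 := by
  simpa [iteratedDeriv_one] using iteratedDeriv_gammaHalf 1

theorem besselT_one_half {x : ℝ} (hx : 0 < x) :
    besselT (1 / 2) x = ((Real.pi / 2 * Real.exp (-x) : ℝ) : ℂ) := by
  have h := powS_mul_gammaHalf_mul_besselT hx (s := 1 / 2) (by norm_num)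
  have hS : powS (1 / 2) x = (Real.sqrt (2 / x) : ℂ) := by
    rw [powS, Real.sqrt_eq_rpow, Complex.ofReal_cpow (by positivity)]
    push_cast
    rfl
  have hr : Real.sqrt (2 / x) * (Real.pi / 2) =
      Real.sqrt Real.pi * Real.sqrt (Real.pi / (2 * x)) := by
    rw [← Real.sqrt_mul Real.pi_pos.le,
      show Real.pi * (Real.pi / (2 * x)) = 2 / x * (Real.pi / 2) ^ 2 by field_simp,
      Real.sqrt_mul (by positivity), Real.sqrt_sq (by positivity)]
  have hrc : (Real.sqrt (2 / x) : ℂ) * (Real.pi / 2) =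
      (Real.sqrt Real.pi : ℂ) * (Real.sqrt (Real.pi / (2 * x)) : ℂ) := by exact_mod_cast hr
  have h0 := powS_ne_zero hx (1 / 2)
  rw [gammaHalf_one_half, besselK_one_half, one_mul] at h
  refine mul_left_cancel₀ h0 (h.trans ?_)
  rw [hS]
  push_cast
  linear_combination -Complex.exp (-x) * hrc

theorem besselT_one_half_ne_zero {x : ℝ} (hx : 0 < x) : besselT (1 / 2) x ≠ 0 := by
  rw [besselT_one_half hx]
  exact_mod_cast (by positivity : Real.pi / 2 * Real.exp (-x) ≠ 0)

theorem re_pos_mem_nhds_one_half : {z : ℂ | 0 < z.re} ∈ 𝓝 (1 / 2 : ℂ) :=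
  (isOpen_lt continuous_const Complex.continuous_re).mem_nhds (by norm_num)

/-- Two derivatives of Basset's formula. -/
theorem iteratedDeriv_two_besselK_div {x : ℝ} (hx : 0 < x) :
    iteratedDeriv 2 (fun s : ℂ => besselK s x) (1 / 2) / besselK (1 / 2) x =
      iteratedDeriv 2 (fun s : ℂ => powS s x) (1 / 2) / powS (1 / 2) x
        + iteratedDeriv 2 gammaHalf (1 / 2) / gammaHalf (1 / 2)
        + iteratedDeriv 2 (fun s : ℂ => besselT s x) (1 / 2) / besselT (1 / 2) x
        + 2 * (deriv (fun s : ℂ => powS s x) (1 / 2) / powS (1 / 2) x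
              * (deriv gammaHalf (1 / 2) / gammaHalf (1 / 2))
            + deriv (fun s : ℂ => powS s x) (1 / 2) / powS (1 / 2) x
              * (deriv (fun s : ℂ => besselT s x) (1 / 2) / besselT (1 / 2) x)
            + deriv gammaHalf (1 / 2) / gammaHalf (1 / 2)
              * (deriv (fun s : ℂ => besselT s x) (1 / 2) / besselT (1 / 2) x)) := by
  have hT := analyticAt_besselT x (s := 1 / 2) (by norm_num)
  have hT0 := besselT_one_half_ne_zero hx
  have hG := analyticAt_gammaHalf
  have hG0 : gammaHalf (1 / 2) ≠ 0 := gammaHalf_one_half_ne_zero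
  have hGT : AnalyticAt ℂ (fun s => gammaHalf s * besselT s x) (1 / 2) := hG.mul hT
  have hev : (fun s => powS s x * (gammaHalf s * besselT s x)) =ᶠ[𝓝 (1 / 2)]
      fun s => (Real.sqrt Real.pi : ℂ) * besselK s x := by
    filter_upwards [re_pos_mem_nhds_one_half] with s hs
    exact powS_mul_gammaHalf_mul_besselT hx hs
  have hpi : (Real.sqrt Real.pi : ℂ) ≠ 0 := by
    exact_mod_cast (Real.sqrt_pos.2 Real.pi_pos).ne'
  have h1 := iteratedDeriv_two_mul_div (analyticAt_powS hx _) hGT (powS_ne_zero hx _)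
    (mul_ne_zero hG0 hT0)
  have h2 := iteratedDeriv_two_mul_div hG hT hG0 hT0
  have h3 := deriv_mul_div hG hT hG0 hT0
  rw [hev.iteratedDeriv_eq, hev.eq_of_nhds, iteratedDeriv_const_mul_field,
    mul_div_mul_left _ _ hpi] at h1
  rw [h1, h2, h3]
  ring

theorem mellin_shiftedKernel_one {x : ℝ} (hx : 0 < x) :
    mellin (fun p => (shiftedKernel x p : ℂ)) 1 = ((2 * Real.exp (-x) / x : ℝ) : ℂ) := by
  have h := mellin_log_pow_mul_shiftedKernel x 0
  have h0 : logIntegral 0 0 0 x = 1 / x := by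
    have := mul_logIntegral_zero_zero_zero hx
    field_simp
    linarith
  have e : ∫ u in Ioi (0 : ℝ), Real.exp (-x * u) * (Real.log u + Real.log (u + 2)) ^ 0 =
      logIntegral 0 0 0 x := by
    rw [logIntegral]
    congr 1
    funext u
    simp
  rw [e, h0] at h
  simpa [mul_one_div, div_eq_mul_inv] using h

theorem besselT_mul_sq_eventuallyEq {x : ℝ} (hx : 0 < x) :
    (fun s => besselT s x * ((powS s x * gammaHalf s) * (powS s x * gammaHalf s))) =ᶠ[𝓝 (1 / 2)]
      fun s => (Real.pi / 2 : ℂ) * mellin (fun p => (shiftedKernel x p : ℂ)) (s + 1 / 2) := by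
  filter_upwards [re_pos_mem_nhds_one_half] with s hs
  exact besselT_mul_sq hx hs

theorem deriv_shiftedKernel_div {x : ℝ} (hx : 0 < x) :
    deriv (mellin (fun p => (shiftedKernel x p : ℂ))) 1 /
      mellin (fun p => (shiftedKernel x p : ℂ)) 1 =
      ((x * (logIntegral 0 1 0 x + logIntegral 1 0 0 x) : ℝ) : ℂ) := by
  have h := mellin_log_pow_mul_shiftedKernel x 1
  rw [integral_exp_mul_log_add_log hx] at h
  rw [((mellinRegular_shiftedKernel hx).hasDerivAt_mellin (s := 1) (by simp)).deriv,
    mellin_shiftedKernel_one hx]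
  simp only [pow_one] at h
  simp only [Complex.real_smul]
  rw [h, ← Complex.ofReal_div]
  congr 1
  field_simp

theorem iteratedDeriv_two_shiftedKernel_div {x : ℝ} (hx : 0 < x) :
    iteratedDeriv 2 (mellin (fun p => (shiftedKernel x p : ℂ))) 1 /
      mellin (fun p => (shiftedKernel x p : ℂ)) 1 =
      ((x * (logIntegral 0 2 0 x + 2 * logIntegral 1 1 0 x + logIntegral 2 0 0 x) : ℝ) : ℂ) := by
  have h := mellin_log_pow_mul_shiftedKernel x 2
  rw [integral_exp_mul_log_add_log_sq hx] at h
  rw [(mellinRegular_shiftedKernel hx).iteratedDeriv_two_mellin (s := 1) (by simp),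
    mellin_shiftedKernel_one hx, h, ← Complex.ofReal_div]
  congr 1
  field_simp

/-- The first logarithmic derivative of `besselT_mul_sq` at `s = 1/2`, solved for that of `T`. -/
theorem deriv_besselT_div {x : ℝ} (hx : 0 < x) :
    deriv (fun s : ℂ => besselT s x) (1 / 2) / besselT (1 / 2) x =
      (expIntegral x : ℂ) + (Real.log x : ℂ) - deriv Complex.Gamma 1 - (Real.log 2 : ℂ) := by
  have hT := analyticAt_besselT x (s := 1 / 2) (by norm_num)
  have hT0 := besselT_one_half_ne_zero hx
  have hS := analyticAt_powS hx (1 / 2)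
  have hS0 := powS_ne_zero hx (1 / 2)
  have hG := analyticAt_gammaHalf
  have hG0 : gammaHalf (1 / 2) ≠ 0 := gammaHalf_one_half_ne_zero
  have hP : AnalyticAt ℂ (fun s => powS s x * gammaHalf s) (1 / 2) := hS.mul hG
  have hPP : AnalyticAt ℂ (fun s => (powS s x * gammaHalf s) * (powS s x * gammaHalf s)) (1 / 2) :=
    hP.mul hP
  have hP0 := mul_ne_zero hS0 hG0
  have hev := besselT_mul_sq_eventuallyEq hx
  have hpi : (Real.pi / 2 : ℂ) ≠ 0 := by exact_mod_cast (half_pos Real.pi_pos).ne'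
  have h1 := deriv_mul_div hT hPP hT0 (mul_ne_zero hP0 hP0)
  have h2 := deriv_mul_div hP hP hP0 hP0
  have h3 := deriv_mul_div hS hG hS0 hG0
  have e := hev.eq_of_nhds
  rw [hev.deriv_eq, e, deriv_const_mul_field, mul_div_mul_left _ _ hpi, deriv_comp_add_const,
    add_halves, deriv_shiftedKernel_div hx, h2, h3, deriv_powS_div hx, deriv_gammaHalf,
    gammaHalf_one_half, div_one] at h1
  have i1 := mul_logIntegral_zero_one hx
  have i2 := congrArg Complex.ofReal (mul_logIntegral_succ hx 0)
  rw [expIntegral_eq_logIntegral hx]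
  push_cast at h1 i2
  simp only [zero_add, pow_one, one_mul] at i2
  linear_combination -h1 + i1 + i2

/-- Two derivatives of `besselT_mul_sq` at `s = 1/2`, solved for `T'' / T`. The terms with
`log x · E(x)` are removed by `logIntegral_add_logIntegral`. -/
theorem iteratedDeriv_two_besselT_div {x : ℝ} (hx : 0 < x) :
    iteratedDeriv 2 (fun s : ℂ => besselT s x) (1 / 2) / besselT (1 / 2) x =
      (Real.log 2 : ℂ) ^ 2 - 2 * riemannZeta 2
        - 2 * (logIntegral 1 0 1 x : ℂ) - 4 * (logIntegral 0 1 1 x : ℂ)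
        + 2 * (x : ℂ) * (logIntegral 1 1 0 x : ℂ) + (x : ℂ) * (logIntegral 0 2 0 x : ℂ) := by
  have hT := analyticAt_besselT x (s := 1 / 2) (by norm_num)
  have hT0 := besselT_one_half_ne_zero hx
  have hS := analyticAt_powS hx (1 / 2)
  have hS0 := powS_ne_zero hx (1 / 2)
  have hG := analyticAt_gammaHalf
  have hG0 : gammaHalf (1 / 2) ≠ 0 := gammaHalf_one_half_ne_zero
  have hP : AnalyticAt ℂ (fun s => powS s x * gammaHalf s) (1 / 2) := hS.mul hG
  have hPP : AnalyticAt ℂ (fun s => (powS s x * gammaHalf s) * (powS s x * gammaHalf s)) (1 / 2) :=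
    hP.mul hP
  have hP0 := mul_ne_zero hS0 hG0
  have hev := besselT_mul_sq_eventuallyEq hx
  have hpi : (Real.pi / 2 : ℂ) ≠ 0 := by exact_mod_cast (half_pos Real.pi_pos).ne'
  have h1 := iteratedDeriv_two_mul_div hT hPP hT0 (mul_ne_zero hP0 hP0)
  have h2 := iteratedDeriv_two_mul_div hP hP hP0 hP0
  have h3 := iteratedDeriv_two_mul_div hS hG hS0 hG0
  have e := hev.eq_of_nhds
  rw [hev.iteratedDeriv_eq, e, iteratedDeriv_const_mul_field, mul_div_mul_left _ _ hpi,
    iteratedDeriv_comp_add_const] at h1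
  simp only [add_halves] at h1
  rw [iteratedDeriv_two_shiftedKernel_div hx, h2, h3, deriv_mul_div hP hP hP0 hP0,
    deriv_mul_div hS hG hS0 hG0, deriv_besselT_div hx, iteratedDeriv_powS_div hx,
    deriv_powS_div hx, deriv_gammaHalf, iteratedDeriv_gammaHalf, gammaHalf_one_half, div_one, div_one,
    expIntegral_eq_logIntegral hx] at h1
  have i0 : x * logIntegral 2 0 0 x = Real.log 2 ^ 2 + 2 * logIntegral 1 0 1 x := by
    have := mul_logIntegral_succ hx 1
    norm_num at this
    exact this
  have i1 := congrArg Complex.ofReal i0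
  have i2 := congrArg Complex.ofReal (logIntegral_add_logIntegral hx)
  have i3 := two_mul_iteratedDeriv_two_Gamma_one
  have i4 := Complex.hasDerivAt_Gamma_one.deriv
  push_cast at h1 i1 i2
  rw [i4] at h1 i3
  linear_combination -h1 + i1 + i3 * (-1 : ℂ) + 4 * i2

end ValuesAtOneHalf

theorem mainTheorem3 (x : ℝ) (hx : 0 < x) :
    -- all functions of the order that are differentiated are holomorphic at `1/2`,
    -- and the values divided by are explicit and nonzero
    AnalyticAt ℂ (fun s : ℂ => besselT s x) (1 / 2) ∧
    AnalyticAt ℂ (fun s : ℂ => besselK s x) (1 / 2) ∧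
    besselT (1 / 2) x = ((Real.pi / 2 * Real.exp (-x) : ℝ) : ℂ) ∧
    besselK (1 / 2) x = ((Real.sqrt (Real.pi / (2 * x)) * Real.exp (-x) : ℝ) : ℂ) ∧
    -- all integrals converge absolutely
    IntegrableOn
      (fun u : ℝ => Real.cos (x * u) * Real.log (u ^ 2 + 1) ^ 2 / (u ^ 2 + 1)) (Ioi 0) ∧
    (∀ a b ε : ℕ, IntegrableOn
      (fun u : ℝ => Real.exp (-x * u) * (Real.log (u + 2) ^ a * Real.log u ^ b / (u + 2) ^ ε))
      (Ioi 0)) ∧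
    IntegrableOn (fun u : ℝ => Real.exp (-u) / (u + 2 * x)) (Ioi 0) ∧
    -- the second derivative of `T` at `s = 1/2`
    iteratedDeriv 2 (fun s : ℂ => besselT s x) (1 / 2) =
      ((∫ u in Ioi (0 : ℝ),
        Real.cos (x * u) * Real.log (u ^ 2 + 1) ^ 2 / (u ^ 2 + 1) : ℝ) : ℂ) ∧
    iteratedDeriv 2 (fun s : ℂ => besselT s x) (1 / 2) / besselT (1 / 2) x =
      (Real.log 2 : ℂ) ^ 2 - 2 * riemannZeta 2
        - 2 * (logIntegral 1 0 1 x : ℂ) - 4 * (logIntegral 0 1 1 x : ℂ)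
        + 2 * (x : ℂ) * (logIntegral 1 1 0 x : ℂ) + (x : ℂ) * (logIntegral 0 2 0 x : ℂ) ∧
    -- the first logarithmic derivative of `T` at `s = 1/2`
    deriv (fun s : ℂ => besselT s x) (1 / 2) / besselT (1 / 2) x =
      (expIntegral x : ℂ) + (Real.log x : ℂ) - deriv Complex.Gamma 1 - (Real.log 2 : ℂ) ∧
    -- the second derivative of `K` at `s = 1/2`
    iteratedDeriv 2 (fun s : ℂ => besselK s x) (1 / 2) / besselK (1 / 2) x =
      iteratedDeriv 2 (fun s : ℂ => powS s x) (1 / 2) / powS (1 / 2) x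
        + iteratedDeriv 2 gammaHalf (1 / 2) / gammaHalf (1 / 2)
        + iteratedDeriv 2 (fun s : ℂ => besselT s x) (1 / 2) / besselT (1 / 2) x
        + 2 * (deriv (fun s : ℂ => powS s x) (1 / 2) / powS (1 / 2) x
              * (deriv gammaHalf (1 / 2) / gammaHalf (1 / 2))
            + deriv (fun s : ℂ => powS s x) (1 / 2) / powS (1 / 2) x
              * (deriv (fun s : ℂ => besselT s x) (1 / 2) / besselT (1 / 2) x)
            + deriv gammaHalf (1 / 2) / gammaHalf (1 / 2)
              * (deriv (fun s : ℂ => besselT s x) (1 / 2) / besselT (1 / 2) x)) ∧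
    -- the cancellation among the terms of the second derivative of `K`
    (x : ℂ) * (logIntegral 0 2 0 x : ℂ) =
      iteratedDeriv 2 Complex.Gamma 1 - 2 * (Real.log x : ℂ) * deriv Complex.Gamma 1
        + (Real.log x : ℂ) ^ 2 ∧
    iteratedDeriv 2 gammaHalf (1 / 2) / gammaHalf (1 / 2)
        + 2 * (deriv gammaHalf (1 / 2) / gammaHalf (1 / 2)
          * (deriv (fun s : ℂ => besselT s x) (1 / 2) / besselT (1 / 2) x))
        + iteratedDeriv 2 (fun s : ℂ => besselT s x) (1 / 2) / besselT (1 / 2) x =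
      (2 * iteratedDeriv 2 Complex.Gamma 1 - 2 * deriv Complex.Gamma 1 ^ 2 - 2 * riemannZeta 2)
        + 2 * deriv Complex.Gamma 1 * ((expIntegral x : ℂ) - (Real.log 2 : ℂ))
        + (Real.log 2 : ℂ) ^ 2 + (Real.log x : ℂ) ^ 2
        - 2 * (logIntegral 1 0 1 x : ℂ) - 4 * (logIntegral 0 1 1 x : ℂ)
        + 2 * (x : ℂ) * (logIntegral 1 1 0 x : ℂ) ∧
    2 * iteratedDeriv 2 Complex.Gamma 1 - 2 * deriv Complex.Gamma 1 ^ 2 - 2 * riemannZeta 2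
      = 0 := by
  have hT := iteratedDeriv_two_besselT_div hx
  refine ⟨analyticAt_besselT x (by norm_num), analyticAt_besselK hx (by norm_num),
    besselT_one_half hx, besselK_one_half x, integrableOn_cos_mul_log_sq x,
    integrableOn_logIntegrand hx, integrableOn_exp_neg_div hx, iteratedDeriv_two_besselT x, hT,
    deriv_besselT_div hx, iteratedDeriv_two_besselK_div hx, mul_logIntegral_zero_two hx, ?_,
    two_mul_iteratedDeriv_two_Gamma_one⟩
  rw [hT, deriv_besselT_div hx, mul_logIntegral_zero_two hx, iteratedDeriv_gammaHalf,
    deriv_gammaHalf, gammaHalf_one_half, div_one, div_one]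
  ring
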